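/- Conventions. A digraph $D$ is a vertex set with a set of ordered pairs of vertices (edges); all digraphs are asymmetric: if $(u,v)$ is an edge then $(v,u)$ is not (in particular there are no loops). Subsets of $D$ carry the full induced digraph structure. For $s\ge 0$, an $s$-arc from $u$ to $v$ is a sequence $u=u_0,u_1,\dots,u_s=v$ with $(u_i,u_{i+1})$ an edge for $0\le i<s$ and $u_{i-1}\neq u_{i+1}$ for $0<i<s$; $D^s(u)$ is the set of vertices reachable from $u$ by an $s$-arc, and the descendant set of $u$ is $D(u)=\mathrm{desc}(u)=\bigcup_{s\ge0}D^s(u)$. For $A\subseteq D$ write $A\le D$ if $\mathrm{desc}(a)\subseteq A$ for all $a\in A$; such an $A$ is finitely generated if $A=\bigcup_{a\in X}\mathrm{desc}(a)$ for some finite $X\subseteq A$ (possibly $X = \emptyset$). Write $A\le^+D$ if $A\le D$ and, for every $b\in D$, (i) if $\mathrm{desc}(b)\setminus A$ is finite then $b\in A$, and (ii) $\mathrm{desc}(b)\cap A$ is finitely generated. A digraph is primitive if its automorphism group acts primitively on its vertices (transitively, with no non-trivial invariant equivalence relation), and distance transitive if for every $s\ge0$ its automorphism group is transitive on the pairs $(u,v)$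 for which there is an $s$-arc from $u$ to $v$ but no $t$-arc with $t<s$. Theorem. Let $\Gamma$ be a digraph with a vertex $\gamma$ such that P0: every vertex of $\Gamma$ is a descendant of $\gamma$, all vertices of $\Gamma$ have the same finite out-valency $m>0$, and $\Gamma^s(\gamma)\cap\Gamma^t(\gamma)=\emptyset$ whenever $s\ne t$; P1: $\Gamma(u)\cong\Gamma$ for all $u\in\Gamma$; P2: $\mathrm{desc}(a)\le^+\Gamma$ for all $a\in\Gamma$; P3: for every $n\ge 0$, $\mathrm{Aut}(\Gamma)$ is transitive on $\Gamma^n(\gamma)$. Then there is a non-empty countable digraph $D_\Gamma$ which is primitive and distance transitive, in which every vertex has infinite in-valency, and in which $\mathrm{desc}(a)\cong\Gamma$ for every vertex $a$. -/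

import Mathlib

namespace Digraph

/-- A digraph without loops and without pairs of oppositely directed edges. -/
def IsAsymmetric {V : Type*} (D : Digraph V) : Prop :=
  ∀ u v, D.Adj u v → ¬ D.Adj v u

/-- Isomorphisms of digraphs. -/
abbrev Iso {V W : Type*} (D : Digraph V) (E : Digraph W) : Type _ :=
  D.Adj ≃r E.Adj

/-- The automorphism group of a digraph; it acts on the vertices by evaluation. -/
abbrev Aut {V : Type*} (D : Digraph V) : Type _ :=
  D.Adj ≃r D.Adj

/-- The full induced subdigraph on a set of vertices. -/
def induced {V : Type*} (D : Digraph V) (A : Set V) : Digraph A where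
  Adj a b := D.Adj a b

/-- The set of out-vertices of `v`. -/
def outSet {V : Type*} (D : Digraph V) (v : V) : Set V := {w | D.Adj v w}

/-- The set of in-vertices of `v`. -/
def inSet {V : Type*} (D : Digraph V) (v : V) : Set V := {w | D.Adj w v}

/-- There is an `s`-arc `p 0, p 1, …, p s` from `u` to `v`
(the values of `p` beyond `s` play no role). -/
def HasArc {V : Type*} (D : Digraph V) (s : ℕ) (u v : V) : Prop :=
  ∃ p : ℕ → V, p 0 = u ∧ p s = v ∧ (∀ i, i < s → D.Adj (p i) (p (i + 1))) ∧
    ∀ i, i + 1 < s → p i ≠ p (i + 2)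

/-- The vertices reachable from `u` by an `s`-arc. -/
def layer {V : Type*} (D : Digraph V) (s : ℕ) (u : V) : Set V := {v | D.HasArc s u v}

/-- The descendant set of `u`. -/
def desc {V : Type*} (D : Digraph V) (u : V) : Set V := ⋃ s, D.layer s u

/-- `A ≤ D`: the set `A` is closed under taking descendants. -/
def IsDescClosed {V : Type*} (D : Digraph V) (A : Set V) : Prop :=
  ∀ a ∈ A, D.desc a ⊆ A

/-- `A ≤ D` is finitely generated (the empty set is, by the empty generating set). -/
def IsFinGen {V : Type*} (D : Digraph V) (A : Set V) : Prop :=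
  D.IsDescClosed A ∧ ∃ X : Set V, X.Finite ∧ X ⊆ A ∧ A = ⋃ a ∈ X, D.desc a

/-- The relation `A ≤⁺ D`. -/
structure IsStrong {V : Type*} (D : Digraph V) (A : Set V) : Prop where
  closed : D.IsDescClosed A
  mem_of_finite_diff : ∀ b, (D.desc b \ A).Finite → b ∈ A
  finGen_inter : ∀ b, D.IsFinGen (D.desc b ∩ A)

/-- P0: `Γ` is rooted at `γ`, has finite constant out-valency `m > 0`, and the layers
below `γ` are pairwise disjoint. -/
structure P0 {V : Type*} (Γ : Digraph V) (γ : V) : Prop where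
  rooted : Γ.desc γ = Set.univ
  outValency : ∃ m : ℕ, 0 < m ∧ ∀ v, (Γ.outSet v).encard = m
  disjoint_layers : ∀ s t : ℕ, s ≠ t → Γ.layer s γ ∩ Γ.layer t γ = ∅

/-- P1: the digraph induced on the descendants of any vertex is isomorphic to `Γ`. -/
def P1 {V : Type*} (Γ : Digraph V) : Prop :=
  ∀ u, Nonempty (Iso (Γ.induced (Γ.desc u)) Γ)

/-- P2: `desc(a) ≤⁺ Γ` for all vertices `a`. -/
def P2 {V : Type*} (Γ : Digraph V) : Prop :=
  ∀ a, Γ.IsStrong (Γ.desc a)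

/-- P3: the automorphism group is transitive on each layer below the root `γ`. -/
def P3 {V : Type*} (Γ : Digraph V) (γ : V) : Prop :=
  ∀ n : ℕ, ∀ u ∈ Γ.layer n γ, ∀ v ∈ Γ.layer n γ, ∃ g : Γ.Aut, g u = v

/-- A digraph is primitive if its automorphism group is primitive on the vertices. -/
def IsPrimitive {V : Type*} (D : Digraph V) : Prop :=
  MulAction.IsPreprimitive D.Aut V

/-- There is an `s`-arc from `u` to `v`, but no `t`-arc with `t < s`. -/
def IsAtDist {V : Type*} (D : Digraph V) (s : ℕ) (u v : V) : Prop :=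
  D.HasArc s u v ∧ ∀ t, t < s → ¬ D.HasArc t u v

/-- Directed distance transitivity. -/
def IsDistanceTransitive {V : Type*} (D : Digraph V) : Prop :=
  ∀ (s : ℕ) (u v u' v' : V), D.IsAtDist s u v → D.IsAtDist s u' v' →
    ∃ g : D.Aut, g u = u' ∧ g v = v'

end Digraph

/-! `IsLocally` records what a digraph needs in order to be locally like `Γ`: every descendant set
is a strong copy of `Γ`. The class is closed under free amalgamation over strong sets. The digraph
is enlarged by amalgamating with it, independently for every isomorphism `φ` between strong sets, a
further copy of itself along `φ` (`step`). Iteration from `Γ` gives a limit in which any isomorphism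
between strong subsets of one level extends to an automorphism: each strong embedding of a level
into the next is undone one level later, which is a back-and-forth (`exists_undo`,
`exists_aut_of_sequence`). The extension can be chosen free: it moves the level off itself except
where forced. `IsFreeFiltration` collects exactly this, and the rest of the argument uses nothing
else about the limit.

Distance transitivity follows from extending isomorphisms of descendant sets, with P3 used to match
the endpoints. Infinite in-valency follows by moving finitely many in-vertices off themselves.

For primitivity, let two distinct vertices be related by an invariant equivalence. Free amalgamation
produces related pairs whose descendant sets meet in prescribed intersections of translates of one
finitely generated set `Z` with infinite complement. P3 makes such intersections reach the empty set
(`P0.empty_mem`): deep enough in `Γ`, a vertex lies in `Z` only if its in-vertices do, so finitely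
many translates that together avoid one deep layer have empty intersection. This gives a related
pair with disjoint descendant sets (`exists_disjoint`), then a related pair whose two descendant
sets also have strong union (`AreFree`). All such pairs form a single orbit, and any two vertices
are both free from some third one, so the equivalence is universal (`rel_of_ne`).

The limit is uncountable, so a Löwenheim–Skolem closure finishes the proof: a countable
descendant-closed subset is taken that is invariant under enough automorphisms to witness every
property (`exists_countable`). -/

namespace Digraph

open Set Relation

universe u v w

/-! ### Walks, descendant sets and strong sets. -/

section Basic

variable {V : Type u} {D : Digraph V}

/-- There is a directed walk of length `s` from `u` to `v`. -/
def HasWalk (D : Digraph V) : ℕ → V → V → Prop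
  | 0, u, v => u = v
  | s + 1, u, v => ∃ w, D.HasWalk s u w ∧ D.Adj w v

/-- Asymmetry rules out immediate backtracking, so the extra condition on arcs is automatic. -/
theorem hasArc_iff_hasWalk (hD : D.IsAsymmetric) {s : ℕ} {u v : V} :
    D.HasArc s u v ↔ D.HasWalk s u v := by
  constructor
  · rintro ⟨p, rfl, rfl, hp, -⟩
    induction s with
    | zero => exact rfl
    | succ s ih => exact ⟨p s, ih fun i hi => hp i (by omega), hp s (by omega)⟩
  · intro h
    obtain ⟨p, h0, hs, hp⟩ : ∃ p : ℕ → V, p 0 = u ∧ p s = v ∧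
        ∀ i, i < s → D.Adj (p i) (p (i + 1)) := by
      induction s generalizing v with
      | zero => exact ⟨fun _ => u, rfl, h, fun i hi => by omega⟩
      | succ s ih =>
        obtain ⟨w, hw, hwv⟩ := h
        obtain ⟨p, h0, hs, hp⟩ := ih hw
        refine ⟨fun i => if i ≤ s then p i else v, by simp [h0], by simp, fun i hi => ?_⟩
        rcases Nat.lt_succ_iff_lt_or_eq.1 hi with h | rfl
        · simpa [h.le, Nat.succ_le_of_lt h] using hp i h
        · simpa [hs] using hwv
    refine ⟨p, h0, hs, hp, fun i hi he => ?_⟩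
    have h1 := hp i (by omega)
    have h2 := hp (i + 1) hi
    rw [show i + 1 + 1 = i + 2 from rfl, ← he] at h2
    exact hD _ _ h1 h2

theorem HasWalk.trans {s t : ℕ} {u v w : V} (h : D.HasWalk s u v) (h' : D.HasWalk t v w) :
    D.HasWalk (s + t) u w := by
  induction t generalizing w with
  | zero => cases h'; exact h
  | succ t ih =>
    obtain ⟨x, hx, hxw⟩ := h'
    exact ⟨x, ih hx, hxw⟩

theorem exists_hasWalk_iff {u v : V} : (∃ s, D.HasWalk s u v) ↔ ReflTransGen D.Adj u v := by
  constructor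
  · rintro ⟨s, h⟩
    induction s generalizing v with
    | zero => cases h; exact .refl
    | succ s ih =>
      obtain ⟨w, hw, hwv⟩ := h
      exact (ih hw).tail hwv
  · intro h
    induction h with
    | refl => exact ⟨0, rfl⟩
    | tail _ h2 ih => exact ⟨_ + 1, _, ih.choose_spec, h2⟩

theorem mem_layer_iff (hD : D.IsAsymmetric) {s : ℕ} {u v : V} :
    v ∈ D.layer s u ↔ D.HasWalk s u v := hasArc_iff_hasWalk hD

theorem mem_desc_iff (hD : D.IsAsymmetric) {u v : V} :
    v ∈ D.desc u ↔ ReflTransGen D.Adj u v := by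
  simp only [desc, mem_iUnion, mem_layer_iff hD, exists_hasWalk_iff]

theorem self_mem_desc (hD : D.IsAsymmetric) (u : V) : u ∈ D.desc u :=
  (mem_desc_iff hD).2 .refl

theorem desc_subset_desc (hD : D.IsAsymmetric) {u v : V} (h : v ∈ D.desc u) :
    D.desc v ⊆ D.desc u := fun _ hw =>
  (mem_desc_iff hD).2 (((mem_desc_iff hD).1 h).trans ((mem_desc_iff hD).1 hw))

theorem isDescClosed_desc (hD : D.IsAsymmetric) (u : V) : D.IsDescClosed (D.desc u) :=
  fun _ h => desc_subset_desc hD h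

theorem isDescClosed_iff (hD : D.IsAsymmetric) {A : Set V} :
    D.IsDescClosed A ↔ ∀ a ∈ A, ∀ b, D.Adj a b → b ∈ A := by
  constructor
  · intro h a ha b hab
    exact h a ha ((mem_desc_iff hD).2 (.single hab))
  · intro h a ha b hb
    rw [mem_desc_iff hD] at hb
    induction hb with
    | refl => exact ha
    | tail _ h2 ih => exact h _ ih _ h2

theorem IsDescClosed.inter {A B : Set V} (hA : D.IsDescClosed A) (hB : D.IsDescClosed B) :
    D.IsDescClosed (A ∩ B) := fun a ha => subset_inter (hA a ha.1) (hB a ha.2)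

theorem IsDescClosed.union {A B : Set V} (hA : D.IsDescClosed A) (hB : D.IsDescClosed B) :
    D.IsDescClosed (A ∪ B) := fun a ha =>
  ha.elim (fun h => (hA a h).trans subset_union_left) fun h => (hB a h).trans subset_union_right

theorem isFinGen_empty (D : Digraph V) : D.IsFinGen ∅ :=
  ⟨fun _ h => h.elim, ∅, finite_empty, Subset.rfl, by simp⟩

theorem isFinGen_desc (hD : D.IsAsymmetric) (u : V) : D.IsFinGen (D.desc u) :=
  ⟨isDescClosed_desc hD u, {u}, finite_singleton u, by simpa using self_mem_desc hD u, by simp⟩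

theorem IsFinGen.union {A B : Set V} (hA : D.IsFinGen A) (hB : D.IsFinGen B) :
    D.IsFinGen (A ∪ B) := by
  obtain ⟨hA, X, hX, hXA, hX'⟩ := hA
  obtain ⟨hB, Y, hY, hYB, hY'⟩ := hB
  exact ⟨hA.union hB, X ∪ Y, hX.union hY, union_subset_union hXA hYB, by
    rw [biUnion_union, ← hX', ← hY']⟩

theorem IsFinGen.biUnion {ι : Type*} {X : Set ι} (hX : X.Finite) {A : ι → Set V}
    (hA : ∀ x ∈ X, D.IsFinGen (A x)) : D.IsFinGen (⋃ x ∈ X, A x) := by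
  induction X, hX using Set.Finite.induction_on with
  | empty => simpa using isFinGen_empty D
  | insert _ _ ih =>
    rw [biUnion_insert]
    exact (hA _ (mem_insert _ _)).union (ih fun x hx => hA x (mem_insert_of_mem _ hx))

/-- Transitivity of strongness, for sets in one digraph. -/
theorem IsStrong.trans {S A : Set V} (hS : D.IsStrong S) (hAS : A ⊆ S)
    (hA : D.IsDescClosed A) (h1 : ∀ c ∈ S, (D.desc c \ A).Finite → c ∈ A)
    (h2 : ∀ c ∈ S, D.IsFinGen (D.desc c ∩ A)) : D.IsStrong A where
  closed := hA
  mem_of_finite_diff b hb :=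
    h1 b (hS.mem_of_finite_diff b (hb.subset (sdiff_subset_sdiff_right hAS))) hb
  finGen_inter b := by
    obtain ⟨-, X, hX, hXS, hXe⟩ := hS.finGen_inter b
    have : D.desc b ∩ A = ⋃ a ∈ X, D.desc a ∩ A := by
      rw [← iUnion₂_inter, ← hXe, inter_assoc, inter_eq_self_of_subset_right hAS]
    rw [this]
    exact IsFinGen.biUnion hX fun x hx => h2 x (hXS hx).2

end Basic

/-! ### Transfer along embeddings with descendant-closed or strong range. -/

section Embedding

variable {V : Type u} {W : Type v} {D : Digraph V} {E : Digraph W} (i : D.Adj ↪r E.Adj)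

theorem IsAsymmetric.of_embedding (hE : E.IsAsymmetric) (i : D.Adj ↪r E.Adj) :
    D.IsAsymmetric := fun _ _ h h' =>
  hE _ _ (i.map_rel_iff.2 h) (i.map_rel_iff.2 h')

theorem desc_apply (hE : E.IsAsymmetric) (hi : E.IsDescClosed (range i)) (x : V) :
    E.desc (i x) = i '' D.desc x := by
  have hD := hE.of_embedding i
  ext y
  constructor
  · intro hy
    rw [mem_desc_iff hE] at hy
    induction hy with
    | refl => exact ⟨x, self_mem_desc hD x, rfl⟩
    | tail _ h2 ih =>
      obtain ⟨z, hz, rfl⟩ := ih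
      obtain ⟨y, rfl⟩ := (isDescClosed_iff hE).1 hi _ ⟨z, rfl⟩ _ h2
      exact ⟨y, (mem_desc_iff hD).2 (((mem_desc_iff hD).1 hz).tail (i.map_rel_iff.1 h2)), rfl⟩
  · rintro ⟨y, hy, rfl⟩
    rw [mem_desc_iff hD] at hy
    exact (mem_desc_iff hE).2 (hy.lift i fun _ _ h => i.map_rel_iff.2 h)

theorem isDescClosed_image_iff (hE : E.IsAsymmetric) (hi : E.IsDescClosed (range i))
    {A : Set V} : E.IsDescClosed (i '' A) ↔ D.IsDescClosed A := by
  simp only [IsDescClosed, forall_mem_image, desc_apply i hE hi, image_subset_image_iff i.injective]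

theorem isFinGen_image_iff (hE : E.IsAsymmetric) (hi : E.IsDescClosed (range i))
    {A : Set V} : E.IsFinGen (i '' A) ↔ D.IsFinGen A := by
  refine and_congr (isDescClosed_image_iff i hE hi) ⟨?_, ?_⟩
  · rintro ⟨X, hX, hXA, hXe⟩
    obtain ⟨X, hXA', rfl⟩ := subset_image_iff.1 hXA
    refine ⟨X, hX.of_finite_image i.injective.injOn, hXA', i.injective.image_injective ?_⟩
    simp only [hXe, biUnion_image, image_iUnion₂, desc_apply i hE hi]
  · rintro ⟨X, hX, hXA, hXe⟩
    refine ⟨i '' X, hX.image i, image_mono hXA, ?_⟩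
    simp only [biUnion_image, desc_apply i hE hi]
    rw [← image_iUnion₂, ← hXe]

theorem IsStrong.of_image (hE : E.IsAsymmetric) (hi : E.IsDescClosed (range i)) {A : Set V}
    (h : E.IsStrong (i '' A)) : D.IsStrong A where
  closed := (isDescClosed_image_iff i hE hi).1 h.closed
  mem_of_finite_diff b hb := by
    have := h.mem_of_finite_diff (i b) (by
      rw [desc_apply i hE hi, ← image_sdiff i.injective]
      exact hb.image i)
    simpa using this
  finGen_inter b := by
    have := h.finGen_inter (i b)
    rwa [desc_apply i hE hi, ← image_inter i.injective, isFinGen_image_iff i hE hi] at this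

/-- Strongness in `E` is also tested at vertices outside the range; strongness of the range reduces
these to vertices inside it. -/
theorem IsStrong.image (hE : E.IsAsymmetric) (hi : E.IsStrong (range i)) {A : Set V}
    (h : D.IsStrong A) : E.IsStrong (i '' A) := by
  have hi' := hi.closed
  refine hi.trans (image_subset_range _ _) ((isDescClosed_image_iff i hE hi').2 h.closed) ?_ ?_
  · rintro _ ⟨b, rfl⟩ hb
    rw [desc_apply i hE hi', ← image_sdiff i.injective] at hb
    exact ⟨b, h.mem_of_finite_diff b (hb.of_finite_image i.injective.injOn), rfl⟩
  · rintro _ ⟨b, rfl⟩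
    rw [desc_apply i hE hi', ← image_inter i.injective, isFinGen_image_iff i hE hi']
    exact h.finGen_inter b

end Embedding

/-- All descendant sets of `D` are strong copies of `Γ`. -/
structure IsLocally {V : Type u} {W : Type v} (Γ : Digraph V) (D : Digraph W) : Prop where
  asymm : D.IsAsymmetric
  exists_embedding : ∀ a, ∃ θ : Γ.Adj ↪r D.Adj, range θ = D.desc a
  strong : ∀ a, D.IsStrong (D.desc a)

/-! ### Consequences of P0, and digraphs locally like `Γ`. -/

section Root

variable {V : Type u} {Γ : Digraph V} {γ : V}

theorem P0.exists_hasWalk (hΓ : Γ.IsAsymmetric) (h0 : Γ.P0 γ) (v : V) :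
    ∃ n, Γ.HasWalk n γ v := by
  rw [exists_hasWalk_iff, ← mem_desc_iff hΓ, h0.rooted]
  trivial

theorem P0.hasWalk_unique (hΓ : Γ.IsAsymmetric) (h0 : Γ.P0 γ) {s t : ℕ} {v : V}
    (hs : Γ.HasWalk s γ v) (ht : Γ.HasWalk t γ v) : s = t := by
  by_contra hne
  have := h0.disjoint_layers s t hne
  have hv : v ∈ Γ.layer s γ ∩ Γ.layer t γ := ⟨(mem_layer_iff hΓ).2 hs, (mem_layer_iff hΓ).2 ht⟩
  rw [this] at hv
  exact hv

theorem P0.antisymm (hΓ : Γ.IsAsymmetric) (h0 : Γ.P0 γ) {x y : V}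
    (hxy : ReflTransGen Γ.Adj x y) (hyx : ReflTransGen Γ.Adj y x) : x = y := by
  obtain ⟨n, hn⟩ := h0.exists_hasWalk hΓ x
  obtain ⟨s, hs⟩ := exists_hasWalk_iff.2 hxy
  obtain ⟨t, ht⟩ := exists_hasWalk_iff.2 hyx
  have := h0.hasWalk_unique hΓ hn ((hn.trans hs).trans ht)
  obtain rfl : s = 0 := by omega
  exact hs

theorem P0.finite_outSet (h0 : Γ.P0 γ) (v : V) : (Γ.outSet v).Finite := by
  obtain ⟨m, -, hm⟩ := h0.outValency
  exact finite_of_encard_eq_coe (hm v)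

theorem P0.exists_adj (h0 : Γ.P0 γ) (v : V) : ∃ w, Γ.Adj v w := by
  obtain ⟨m, hm, hv⟩ := h0.outValency
  have : (Γ.outSet v).Nonempty := by
    rw [← encard_ne_zero, hv v]
    exact_mod_cast hm.ne'
  exact this

theorem P0.exists_hasWalk_from (h0 : Γ.P0 γ) (n : ℕ) (u : V) : ∃ v, Γ.HasWalk n u v := by
  induction n with
  | zero => exact ⟨u, rfl⟩
  | succ n ih =>
    obtain ⟨w, hw⟩ := ih
    obtain ⟨v, hv⟩ := h0.exists_adj w
    exact ⟨v, w, hw, hv⟩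

theorem P0.finite_hasWalk (h0 : Γ.P0 γ) (n : ℕ) (u : V) : {v | Γ.HasWalk n u v}.Finite := by
  induction n with
  | zero => exact (finite_singleton u).subset fun v hv => by cases hv; rfl
  | succ n ih =>
    exact (ih.biUnion fun w _ => h0.finite_outSet w).subset fun v ⟨w, hw, hwv⟩ =>
      mem_biUnion hw hwv

theorem P0.infinite (hΓ : Γ.IsAsymmetric) (h0 : Γ.P0 γ) : Infinite V := by
  choose f hf using fun n => h0.exists_hasWalk_from n γ
  exact Infinite.of_injective f fun s t h => h0.hasWalk_unique hΓ (hf s) (h ▸ hf t)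

theorem P0.countable (hΓ : Γ.IsAsymmetric) (h0 : Γ.P0 γ) : Countable V := by
  rw [← countable_univ_iff]
  refine (countable_iUnion fun n => (h0.finite_hasWalk n γ).countable).mono fun v _ => ?_
  exact mem_iUnion.2 (h0.exists_hasWalk hΓ v)

variable {W : Type v} {D : Digraph W}

/-- The root is the only vertex of `Γ` with all of `Γ` as descendant set, because mutually reachable
vertices coincide. -/
theorem embedding_apply_root (hΓ : Γ.IsAsymmetric) (h0 : Γ.P0 γ) (hD : D.IsAsymmetric)
    {θ : Γ.Adj ↪r D.Adj} {a : W} (hθ : range θ = D.desc a) : θ γ = a := by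
  have hcl : D.IsDescClosed (range θ) := hθ ▸ isDescClosed_desc hD a
  obtain ⟨x, rfl⟩ : a ∈ range θ := hθ ▸ self_mem_desc hD a
  rw [desc_apply θ hD hcl, ← image_univ, image_eq_image θ.injective] at hθ
  have h1 : γ ∈ Γ.desc x := hθ ▸ mem_univ _
  have h2 : x ∈ Γ.desc γ := h0.rooted ▸ mem_univ _
  rw [mem_desc_iff hΓ] at h1 h2
  rw [h0.antisymm hΓ h1 h2]

theorem IsLocally.antisymm (hΓ : Γ.IsAsymmetric) (h0 : Γ.P0 γ) (hD : Γ.IsLocally D) {a b : W}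
    (hab : a ∈ D.desc b) (hba : b ∈ D.desc a) : a = b := by
  obtain ⟨θ, hθ⟩ := hD.exists_embedding a
  have hcl : D.IsDescClosed (range θ) := hθ ▸ isDescClosed_desc hD.asymm a
  obtain ⟨x, rfl⟩ : a ∈ range θ := hθ ▸ self_mem_desc hD.asymm a
  obtain ⟨y, rfl⟩ : b ∈ range θ := hθ ▸ hba
  rw [desc_apply θ hD.asymm hcl, θ.injective.mem_set_image, mem_desc_iff hΓ] at hab hba
  rw [h0.antisymm hΓ hba hab]

theorem IsLocally.infinite_desc (hΓ : Γ.IsAsymmetric) (h0 : Γ.P0 γ) (hD : Γ.IsLocally D) (a : W) :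
    (D.desc a).Infinite := by
  obtain ⟨θ, hθ⟩ := hD.exists_embedding a
  have := h0.infinite hΓ
  rw [← hθ]
  exact infinite_range_of_injective θ.injective

theorem IsLocally.countable_desc (hΓ : Γ.IsAsymmetric) (h0 : Γ.P0 γ) (hD : Γ.IsLocally D) (a : W) :
    (D.desc a).Countable := by
  obtain ⟨θ, hθ⟩ := hD.exists_embedding a
  have := h0.countable hΓ
  rw [← hθ]
  exact countable_range θ

/-- Holds because descendant sets are infinite. It makes the empty map a partial isomorphism, hence
subject to free extension. -/
theorem IsLocally.isStrong_empty (hΓ : Γ.IsAsymmetric) (h0 : Γ.P0 γ) (hD : Γ.IsLocally D) :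
    D.IsStrong ∅ where
  closed := fun _ h => h.elim
  mem_of_finite_diff b hb := (hD.infinite_desc hΓ h0 b (by simpa using hb)).elim
  finGen_inter b := by simpa using isFinGen_empty D

theorem isLocally_self (hΓ : Γ.IsAsymmetric) (h1 : Γ.P1) (h2 : Γ.P2) : Γ.IsLocally Γ where
  asymm := hΓ
  exists_embedding a := by
    obtain ⟨e⟩ := h1 a
    refine ⟨⟨⟨fun x => (e.symm x : V), fun x y h => e.symm.injective (Subtype.ext h)⟩,
      fun {x y} => e.symm.map_rel_iff⟩, ?_⟩
    ext x
    constructor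
    · rintro ⟨y, rfl⟩
      exact (e.symm y).2
    · intro hx
      exact ⟨e ⟨x, hx⟩, congrArg Subtype.val (e.symm_apply_apply ⟨x, hx⟩)⟩
  strong := h2

theorem IsLocally.nonempty_iso (hD : Γ.IsLocally D) (a : W) :
    Nonempty (Iso (D.induced (D.desc a)) Γ) := by
  obtain ⟨θ, hθ⟩ := hD.exists_embedding a
  refine ⟨RelIso.symm ⟨Equiv.ofBijective
    (fun x => (⟨θ x, hθ ▸ mem_range_self x⟩ : D.desc a)) ⟨fun x y h => ?_, ?_⟩, ?_⟩⟩
  · exact θ.injective (congrArg Subtype.val h)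
  · rintro ⟨y, hy⟩
    obtain ⟨x, rfl⟩ : y ∈ range θ := hθ ▸ hy
    exact ⟨x, rfl⟩
  · exact θ.map_rel_iff

end Root

/-! ### Finitely generated subsets of `Γ` in deep layers. -/

section Threshold

variable {V : Type u} {Γ : Digraph V} {γ : V}

theorem HasWalk.map {W : Type v} {D : Digraph W} (g : Γ.Adj ↪r D.Adj) {n : ℕ} {u v : V}
    (h : Γ.HasWalk n u v) : D.HasWalk n (g u) (g v) := by
  induction n generalizing v with
  | zero => exact congrArg g h
  | succ n ih =>
    obtain ⟨w, hw, hwv⟩ := h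
    exact ⟨g w, ih hw, g.map_rel_iff.2 hwv⟩

theorem P0.aut_root (hΓ : Γ.IsAsymmetric) (h0 : Γ.P0 γ) (g : Γ.Aut) : g γ = γ := by
  refine embedding_apply_root hΓ h0 hΓ (θ := g.toRelEmbedding) (a := γ) ?_
  rw [h0.rooted]
  exact g.surjective.range_eq

theorem P0.hasWalk_aut (hΓ : Γ.IsAsymmetric) (h0 : Γ.P0 γ) (g : Γ.Aut) {n : ℕ} {v : V}
    (h : Γ.HasWalk n γ v) : Γ.HasWalk n γ (g v) := by
  have := h.map g.toRelEmbedding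
  rwa [show g.toRelEmbedding γ = γ from h0.aut_root hΓ g] at this

/-- The vertices in the `k`-th layer which have `v` as a descendant. -/
def ancestors (Γ : Digraph V) (γ : V) (k : ℕ) (v : V) : Set V :=
  {u | Γ.HasWalk k γ u ∧ ReflTransGen Γ.Adj u v}

theorem P0.ncard_ancestors_le (hΓ : Γ.IsAsymmetric) (h0 : Γ.P0 γ) (h3 : Γ.P3 γ) {k n : ℕ}
    {v w : V} (hv : Γ.HasWalk n γ v) (hw : Γ.HasWalk n γ w) :
    (Γ.ancestors γ k v).ncard ≤ (Γ.ancestors γ k w).ncard := by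
  obtain ⟨g, rfl⟩ := h3 n v ((mem_layer_iff hΓ).2 hv) w ((mem_layer_iff hΓ).2 hw)
  refine ncard_le_ncard_of_injOn g (fun u hu => ?_) g.injective.injOn
    ((h0.finite_hasWalk k γ).subset fun u hu => hu.1)
  exact ⟨h0.hasWalk_aut hΓ g hu.1, hu.2.lift g fun _ _ h => g.map_rel_iff.2 h⟩

/-- By P3 the number of ancestors in layer `k` depends only on the layer of the vertex. It cannot
decrease along edges and is bounded by the size of layer `k`, so it stabilises; from then on an edge
adds no ancestor. -/
theorem P0.exists_threshold_ancestors (hΓ : Γ.IsAsymmetric) (h0 : Γ.P0 γ) (h3 : Γ.P3 γ) (k : ℕ) :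
    ∃ N, ∀ n ≥ N, ∀ v w, Γ.HasWalk n γ w → Γ.Adj w v →
      Γ.ancestors γ k v ⊆ Γ.ancestors γ k w := by
  choose x hx using fun n => h0.exists_hasWalk_from n γ
  let f : ℕ → ℕ := fun n => (Γ.ancestors γ k (x n)).ncard
  have hfin : ∀ v, (Γ.ancestors γ k v).Finite := fun v =>
    (h0.finite_hasWalk k γ).subset fun u hu => hu.1
  have hb : BddAbove (range f) := ⟨{v | Γ.HasWalk k γ v}.ncard, by
    rintro _ ⟨n, rfl⟩
    exact ncard_le_ncard (fun u hu => hu.1) (h0.finite_hasWalk k γ)⟩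
  obtain ⟨N, hN⟩ := Nat.sSup_mem (range_nonempty f) hb
  have hmax : ∀ n, f n ≤ f N := fun n => hN ▸ le_csSup hb (mem_range_self n)
  have hsub : ∀ v w, Γ.Adj w v → Γ.ancestors γ k w ⊆ Γ.ancestors γ k v :=
    fun v w hwv u hu => ⟨hu.1, hu.2.tail hwv⟩
  have hcard : ∀ n v, Γ.HasWalk n γ v → (Γ.ancestors γ k v).ncard = f n := fun n v hv =>
    (h0.ncard_ancestors_le hΓ h3 hv (hx n)).antisymm (h0.ncard_ancestors_le hΓ h3 (hx n) hv)
  have hmono : Monotone f := monotone_nat_of_le_succ fun n => by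
    obtain ⟨w, hw, hwx⟩ := hx (n + 1)
    rw [← hcard n w hw]
    exact ncard_le_ncard (hsub _ _ hwx) (hfin _)
  refine ⟨N, fun n hn v w hw hwv => ?_⟩
  refine (eq_of_subset_of_ncard_le (hsub v w hwv) ?_ (hfin v)).ge
  rw [hcard n w hw, hcard (n + 1) v ⟨w, hw, hwv⟩]
  exact (hmax _).trans (hmono hn)

theorem P0.exists_threshold (hΓ : Γ.IsAsymmetric) (h0 : Γ.P0 γ) (h3 : Γ.P3 γ) {Z : Set V}
    (hZ : Γ.IsFinGen Z) :
    ∃ N, ∀ n ≥ N, ∀ v w, Γ.HasWalk n γ w → Γ.Adj w v → v ∈ Z → w ∈ Z := by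
  obtain ⟨-, X, hX, -, rfl⟩ := hZ
  choose l hl using fun u => h0.exists_hasWalk hΓ u
  choose N hN using h0.exists_threshold_ancestors hΓ h3
  obtain ⟨M, hM⟩ := (hX.image fun u => N (l u)).bddAbove
  refine ⟨M, fun n hn v w hw hwv hv => ?_⟩
  obtain ⟨u, hu, huv⟩ := mem_iUnion₂.1 hv
  refine mem_iUnion₂.2 ⟨u, hu, (mem_desc_iff hΓ).2 ?_⟩
  exact (hN (l u) n ((hM ⟨u, hu, rfl⟩).trans hn) v w hw hwv
    ⟨hl u, (mem_desc_iff hΓ).1 huv⟩).2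

/-- A family of sets of vertices closed under automorphisms and intersections which contains
a finitely generated set with infinite complement contains the empty set. -/
theorem P0.empty_mem (hΓ : Γ.IsAsymmetric) (h0 : Γ.P0 γ) (h3 : Γ.P3 γ) {𝒮 : Set (Set V)}
    (haut : ∀ g : Γ.Aut, ∀ Z ∈ 𝒮, g '' Z ∈ 𝒮) (hinter : ∀ Y ∈ 𝒮, ∀ Z ∈ 𝒮, Y ∩ Z ∈ 𝒮)
    {Z : Set V} (hZ : Z ∈ 𝒮) (hfg : Γ.IsFinGen Z) (hinf : Zᶜ.Infinite) : ∅ ∈ 𝒮 := by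
  obtain ⟨N, hN⟩ := h0.exists_threshold hΓ h3 hfg
  obtain ⟨x, hx, hxZ⟩ : ∃ x, Γ.HasWalk N γ x ∧ x ∉ Z := by
    by_contra! hcon
    refine hinf (((finite_lt_nat N).biUnion fun n _ => h0.finite_hasWalk n γ).subset ?_)
    intro v hv
    obtain ⟨n, hn⟩ := h0.exists_hasWalk hΓ v
    refine mem_biUnion (x := n) (show n < N from not_le.1 fun hle => hv ?_) hn
    obtain ⟨t, rfl⟩ := Nat.exists_eq_add_of_le hle
    clear hv hle
    induction t generalizing v with
    | zero => exact hcon v hn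
    | succ t ih =>
      obtain ⟨w, hw, hwv⟩ := hn
      exact (isDescClosed_iff hΓ).1 hfg.1 _ (ih hw) _ hwv
  -- Unlike finite generation, this property with its fixed threshold `N` visibly survives both
  -- translation and intersection.
  let P : Set V → Prop := fun Y => Γ.IsDescClosed Y ∧
    ∀ n ≥ N, ∀ v w, Γ.HasWalk n γ w → Γ.Adj w v → v ∈ Y → w ∈ Y
  have hPg : ∀ g : Γ.Aut, P (g '' Z) := by
    refine fun g => ⟨(isDescClosed_image_iff g.toRelEmbedding hΓ ?_).2 hfg.1, ?_⟩
    · exact fun _ _ _ _ => g.surjective _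
    · rintro n hn _ w hw hwv ⟨v, hv, rfl⟩
      refine ⟨g.symm w, hN n hn v _ (h0.hasWalk_aut hΓ g.symm hw) ?_ hv, g.apply_symm_apply w⟩
      rw [← g.map_rel_iff, g.apply_symm_apply]
      exact hwv
  -- Each vertex `v` of the layer is removed by intersecting with a translate of `Z` that carries
  -- the missing vertex `x` to `v`.
  have key : ∀ F : Set V, F.Finite → (∀ v ∈ F, Γ.HasWalk N γ v) →
      ∃ Y ∈ 𝒮, P Y ∧ ∀ v ∈ F, v ∉ Y := by
    intro F hF
    induction F, hF using Set.Finite.induction_on with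
    | empty => exact fun _ => ⟨Z, hZ, ⟨hfg.1, hN⟩, by simp⟩
    | @insert v F _ _ ih =>
      intro hF
      obtain ⟨Y, hY, hPY, hYF⟩ := ih fun v hv => hF v (mem_insert_of_mem _ hv)
      obtain ⟨g, hg⟩ := h3 N x ((mem_layer_iff hΓ).2 hx) v
        ((mem_layer_iff hΓ).2 (hF v (mem_insert _ _)))
      refine ⟨Y ∩ g '' Z, hinter _ hY _ (haut g Z hZ), ⟨hPY.1.inter (hPg g).1,
        fun n hn v w hw hwv h => ⟨hPY.2 n hn v w hw hwv h.1, (hPg g).2 n hn v w hw hwv h.2⟩⟩, ?_⟩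
      rintro u (rfl | hu) ⟨h1, y, hy, hyu⟩
      · rw [← hg] at hyu
        exact hxZ (g.injective hyu ▸ hy)
      · exact hYF u hu h1
  obtain ⟨Y, hY, ⟨hcl, hin⟩, hYN⟩ := key _ (h0.finite_hasWalk N γ) fun v hv => hv
  have hge : ∀ t v, Γ.HasWalk (N + t) γ v → v ∉ Y := by
    intro t
    induction t with
    | zero => exact hYN
    | succ t ih =>
      rintro v ⟨w, hw, hwv⟩ hv
      exact ih w hw (hin _ (Nat.le_add_right _ _) _ _ hw hwv hv)
  -- A vertex of `Y` would have its descendants in `Y`, some of them in layers beyond `N`, where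
  -- nothing is left.
  have hempty : Y = ∅ := by
    refine eq_empty_of_forall_notMem fun y hy => ?_
    obtain ⟨n, hn⟩ := h0.exists_hasWalk hΓ y
    obtain ⟨z, hz⟩ := h0.exists_hasWalk_from N y
    refine hge n z (Nat.add_comm n N ▸ hn.trans hz) (hcl y hy ((mem_desc_iff hΓ).2 ?_))
    exact exists_hasWalk_iff.1 ⟨N, hz⟩
  exact hempty ▸ hY

end Threshold

/-! ### Free amalgamation along all partial isomorphisms. -/

section Step

/-- An isomorphism between strong sets of vertices (the values outside `dom` play no role). -/
structure PartialIso {W : Type v} (D : Digraph W) where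
  dom : Set W
  toFun : W → W
  injOn : InjOn toFun dom
  adj_iff : ∀ x ∈ dom, ∀ y ∈ dom, D.Adj (toFun x) (toFun y) ↔ D.Adj x y
  strong_dom : D.IsStrong dom
  strong_image : D.IsStrong (toFun '' dom)

variable {V : Type u} {W : Type v} {Γ : Digraph V} {D : Digraph W}

theorem exists_partialIso {X : Type w} {E : Digraph X} (i i' : E.Adj ↪r D.Adj)
    (hi : D.IsStrong (range i)) (hi' : D.IsStrong (range i')) :
    ∃ φ : D.PartialIso, φ.dom = range i ∧ ∀ x, φ.toFun (i x) = i' x := by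
  have he : ∀ x, Function.extend i i' id (i x) = i' x := i.injective.extend_apply i' id
  refine ⟨⟨range i, Function.extend i i' id, ?_, ?_, hi, ?_⟩, rfl, he⟩
  · rintro _ ⟨x, rfl⟩ _ ⟨y, rfl⟩ h
    rw [he, he] at h
    rw [i'.injective h]
  · rintro _ ⟨x, rfl⟩ _ ⟨y, rfl⟩
    rw [he, he, i.map_rel_iff, i'.map_rel_iff]
  · rw [← range_comp]
    convert hi' using 2
    exact funext he

/-- The vertices which are added to `D` in order to extend all its partial isomorphisms. -/
abbrev Extra (D : Digraph W) : Type v := Σ φ : D.PartialIso, {x : W // x ∉ φ.dom}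

/-- The free amalgam of `D` with copies of `D`, one for each partial isomorphism `φ`, in which
`φ.dom` in the copy is identified with its image under `φ` in `D`. -/
def step (D : Digraph W) : Digraph (W ⊕ D.Extra) where
  Adj
    | .inl x, .inl y => D.Adj x y
    | .inl _, .inr _ => False
    | .inr p, .inl z => ∃ y ∈ p.1.dom, D.Adj p.2.1 y ∧ p.1.toFun y = z
    | .inr p, .inr q => p.1 = q.1 ∧ D.Adj p.2.1 q.2.1

theorem IsAsymmetric.step (hD : D.IsAsymmetric) : D.step.IsAsymmetric := by
  rintro (x | p) (y | q) h h'
  · exact hD _ _ h h'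
  · exact h
  · exact h'
  · exact hD _ _ h.2 h'.2

/-- The inclusion of `D` into `D.step`. -/
def incl (D : Digraph W) : D.Adj ↪r D.step.Adj := ⟨⟨Sum.inl, Sum.inl_injective⟩, Iff.rfl⟩

open Classical in
/-- The inclusion of the copy of `D` belonging to `φ`. -/
noncomputable def copyFun (φ : D.PartialIso) (x : W) : W ⊕ D.Extra :=
  if hx : x ∈ φ.dom then .inl (φ.toFun x) else .inr ⟨φ, x, hx⟩

theorem copyFun_of_mem (φ : D.PartialIso) {x : W} (hx : x ∈ φ.dom) :
    copyFun φ x = .inl (φ.toFun x) := dif_pos hx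

theorem copyFun_of_notMem (φ : D.PartialIso) {x : W} (hx : x ∉ φ.dom) :
    copyFun φ x = .inr ⟨φ, x, hx⟩ := dif_neg hx

theorem copyFun_injective (φ : D.PartialIso) : Function.Injective (copyFun φ) := by
  intro x y h
  by_cases hx : x ∈ φ.dom <;> by_cases hy : y ∈ φ.dom <;>
    simp only [copyFun_of_mem, copyFun_of_notMem, hx, hy, not_false_eq_true] at h
  · exact φ.injOn hx hy (Sum.inl_injective h)
  · cases h
  · cases h
  · cases h; rfl

/-- The critical case is an edge from `φ.dom` to its complement: the amalgam has none, and `D` has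
none since `φ.dom` is descendant-closed. -/
theorem copyFun_adj_iff (hD : D.IsAsymmetric) (φ : D.PartialIso) {x y : W} :
    D.step.Adj (copyFun φ x) (copyFun φ y) ↔ D.Adj x y := by
  by_cases hx : x ∈ φ.dom <;> by_cases hy : y ∈ φ.dom <;>
    simp only [copyFun_of_mem, copyFun_of_notMem, hx, hy, not_false_eq_true]
  · exact φ.adj_iff x hx y hy
  · exact ⟨False.elim, fun h => hy ((isDescClosed_iff hD).1 φ.strong_dom.closed x hx y h)⟩
  · constructor
    · rintro ⟨z, hz, hxz, he⟩
      rwa [← φ.injOn hz hy he]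
    · exact fun h => ⟨y, hy, h, rfl⟩
  · exact and_iff_right rfl

/-- The embedding of `D` onto the copy of `D` belonging to `φ`. -/
noncomputable def copy (hD : D.IsAsymmetric) (φ : D.PartialIso) : D.Adj ↪r D.step.Adj :=
  ⟨⟨copyFun φ, copyFun_injective φ⟩, copyFun_adj_iff hD φ⟩

theorem copy_of_mem (hD : D.IsAsymmetric) (φ : D.PartialIso) {x : W} (hx : x ∈ φ.dom) :
    copy hD φ x = D.incl (φ.toFun x) := copyFun_of_mem φ hx

theorem copy_of_notMem (hD : D.IsAsymmetric) (φ : D.PartialIso) {x : W} (hx : x ∉ φ.dom) :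
    copy hD φ x = Sum.inr ⟨φ, x, hx⟩ := copyFun_of_notMem φ hx

theorem copy_eq_incl (hD : D.IsAsymmetric) (φ : D.PartialIso) {x y : W}
    (h : copy hD φ x = D.incl y) : x ∈ φ.dom ∧ φ.toFun x = y := by
  by_cases hx : x ∈ φ.dom
  · rw [copy_of_mem hD φ hx] at h
    exact ⟨hx, D.incl.injective h⟩
  · rw [copy_of_notMem hD φ hx] at h
    cases h

theorem isDescClosed_range_incl (hD : D.IsAsymmetric) : D.step.IsDescClosed (range D.incl) := by
  rw [isDescClosed_iff hD.step]
  rintro _ ⟨x, rfl⟩ (y | p) h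
  · exact ⟨y, rfl⟩
  · exact h.elim

theorem isDescClosed_range_copy (hD : D.IsAsymmetric) (φ : D.PartialIso) :
    D.step.IsDescClosed (range (copy hD φ)) := by
  rw [isDescClosed_iff hD.step]
  rintro _ ⟨x, rfl⟩ b h
  by_cases hx : x ∈ φ.dom
  · rw [copy_of_mem hD φ hx] at h
    rcases b with y | p
    · obtain ⟨z, hz, rfl⟩ := (isDescClosed_iff hD).1 φ.strong_image.closed _ ⟨x, hx, rfl⟩ y h
      exact ⟨z, copy_of_mem hD φ hz⟩
    · exact h.elim
  · rw [copy_of_notMem hD φ hx] at h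
    rcases b with y | ⟨ψ, y, hy⟩
    · obtain ⟨z, hz, -, rfl⟩ := h
      exact ⟨z, copy_of_mem hD φ hz⟩
    · obtain rfl : φ = ψ := h.1
      exact ⟨y, copy_of_notMem hD φ hy⟩

/-- A descendant set starting in a copy meets `D` exactly in the glued part, so the claim reduces to
strongness of `φ.dom`. -/
theorem isStrong_range_incl (hD : D.IsAsymmetric) : D.step.IsStrong (range D.incl) := by
  have hcl := isDescClosed_range_incl hD
  have hinr : ∀ (φ : D.PartialIso) (x : W), D.step.desc (copy hD φ x) ∩ range D.incl =
      copy hD φ '' (D.desc x ∩ φ.dom) := by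
    intro φ x
    rw [desc_apply _ hD.step (isDescClosed_range_copy hD φ)]
    ext z
    constructor
    · rintro ⟨⟨y, hy, rfl⟩, ⟨z, hz⟩⟩
      exact ⟨y, ⟨hy, (copy_eq_incl hD φ hz.symm).1⟩, rfl⟩
    · rintro ⟨y, ⟨hy, hyφ⟩, rfl⟩
      exact ⟨⟨y, hy, rfl⟩, ⟨_, (copy_of_mem hD φ hyφ).symm⟩⟩
  refine ⟨hcl, ?_, ?_⟩
  · rintro (x | ⟨φ, x, hx⟩) h
    · exact ⟨x, rfl⟩
    · rw [← copy_of_notMem hD φ hx, ← sdiff_inter_self_eq_sdiff, inter_comm, hinr,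
        desc_apply _ hD.step (isDescClosed_range_copy hD φ), ← image_sdiff (copy hD φ).injective,
        sdiff_self_inter] at h
      exact (hx (φ.strong_dom.mem_of_finite_diff x
        (h.of_finite_image (copy hD φ).injective.injOn))).elim
  · rintro (x | ⟨φ, x, hx⟩)
    · rw [inter_eq_self_of_subset_left (hcl (Sum.inl x) ⟨x, rfl⟩)]
      exact isFinGen_desc hD.step _
    · rw [← copy_of_notMem hD φ hx, hinr,
        isFinGen_image_iff _ hD.step (isDescClosed_range_copy hD φ)]
      exact φ.strong_dom.finGen_inter x

/-- Distinct pieces of the amalgam meet inside `D`. -/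
theorem desc_inter_range_copy (hD : D.IsAsymmetric) (φ : D.PartialIso) {b : W ⊕ D.Extra}
    (hb : b ∉ range (copy hD φ)) :
    D.step.desc b ∩ range (copy hD φ) ⊆ range D.incl := by
  rcases b with x | ⟨ψ, x, hx⟩
  · exact inter_subset_left.trans (isDescClosed_range_incl hD _ ⟨x, rfl⟩)
  · rw [← copy_of_notMem hD ψ hx, desc_apply _ hD.step (isDescClosed_range_copy hD ψ)]
    rintro _ ⟨⟨y, hy, rfl⟩, z, hz⟩
    by_cases hy' : y ∈ ψ.dom
    · exact ⟨_, (copy_of_mem hD ψ hy').symm⟩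
    by_cases hz' : z ∈ φ.dom
    · exact ⟨_, (copy_of_mem hD φ hz').symm.trans hz⟩
    rw [copy_of_notMem hD ψ hy', copy_of_notMem hD φ hz'] at hz
    obtain rfl : φ = ψ := congrArg Sigma.fst (Sum.inr_injective hz)
    exact (hb ⟨x, copy_of_notMem hD φ hx⟩).elim

/-- From outside, the copy is entered only through the image of `φ`, which is strong in `D` and
hence in the amalgam. -/
theorem isStrong_range_copy (hD : D.IsAsymmetric) (φ : D.PartialIso) :
    D.step.IsStrong (range (copy hD φ)) := by
  have hcl := isDescClosed_range_copy hD φ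
  have hst := IsStrong.image D.incl hD.step (isStrong_range_incl hD) φ.strong_image
  have hsub : D.incl '' (φ.toFun '' φ.dom) ⊆ range (copy hD φ) := by
    rintro _ ⟨_, ⟨x, hx, rfl⟩, rfl⟩
    exact ⟨x, copy_of_mem hD φ hx⟩
  have hinter : ∀ b ∉ range (copy hD φ), D.step.desc b ∩ range (copy hD φ) =
      D.step.desc b ∩ D.incl '' (φ.toFun '' φ.dom) := by
    intro b hb
    refine Subset.antisymm ?_ (inter_subset_inter_right _ hsub)
    intro z hz
    refine ⟨hz.1, ?_⟩
    obtain ⟨y, rfl⟩ := desc_inter_range_copy hD φ hb hz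
    obtain ⟨x, hx⟩ := hz.2
    obtain ⟨h1, rfl⟩ := copy_eq_incl hD φ hx
    exact ⟨_, ⟨x, h1, rfl⟩, rfl⟩
  refine ⟨hcl, fun b hfin => ?_, fun b => ?_⟩
  · by_contra hb
    rw [← sdiff_self_inter, hinter b hb, sdiff_self_inter] at hfin
    exact hb (hsub (hst.mem_of_finite_diff b hfin))
  · by_cases hb : b ∈ range (copy hD φ)
    · rw [inter_eq_self_of_subset_left (hcl _ hb)]
      exact isFinGen_desc hD.step _
    · rw [hinter b hb]
      exact hst.finGen_inter b

theorem IsLocally.step (hD : Γ.IsLocally D) : Γ.IsLocally D.step := by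
  have key : ∀ (i : D.Adj ↪r D.step.Adj) (_ : D.step.IsStrong (range i)) (x : W),
      (∃ θ : Γ.Adj ↪r D.step.Adj, range θ = D.step.desc (i x)) ∧
        D.step.IsStrong (D.step.desc (i x)) := by
    intro i hi x
    rw [desc_apply i hD.asymm.step hi.closed]
    refine ⟨?_, IsStrong.image i hD.asymm.step hi (hD.strong x)⟩
    obtain ⟨θ, hθ⟩ := hD.exists_embedding x
    exact ⟨θ.trans i, by rw [← hθ, ← range_comp]; rfl⟩
  have key' : ∀ a, (∃ θ : Γ.Adj ↪r D.step.Adj, range θ = D.step.desc a) ∧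
        D.step.IsStrong (D.step.desc a) := by
    rintro (x | ⟨φ, x, hx⟩)
    · exact key D.incl (isStrong_range_incl hD.asymm) x
    · rw [← copy_of_notMem hD.asymm φ hx]
      exact key _ (isStrong_range_copy hD.asymm φ) x
  exact ⟨hD.asymm.step, fun a => (key' a).1, fun a => (key' a).2⟩

/-- A strong embedding of `D` into `D.step` is undone by one of `D.step` into `D.step.step`. -/
theorem exists_undo (hD : D.IsAsymmetric) (h : D.Adj ↪r D.step.Adj)
    (hs : D.step.IsStrong (range h)) :
    ∃ h' : D.step.Adj ↪r D.step.step.Adj, D.step.step.IsStrong (range h') ∧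
      ∀ x, h' (h x) = D.step.incl (D.incl x) := by
  -- The inverse of `h` is itself a partial isomorphism of `D.step`, so the next step contains a
  -- copy glued along it.
  obtain ⟨φ, hφ, hφ'⟩ := exists_partialIso h D.incl hs (isStrong_range_incl hD)
  refine ⟨copy hD.step φ, isStrong_range_copy hD.step φ, fun x => ?_⟩
  rw [copy_of_mem hD.step φ (hφ ▸ mem_range_self x), hφ']

end Step

/-! ### The limit of the tower and its automorphisms. -/

section Limit

variable {V : Type u} {W : Type v} {Γ : Digraph V} {D : Digraph W}

/-- The digraphs obtained from `D` by iterating `Digraph.step`, with their vertex types. -/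
def towerSigma (D : Digraph W) : ℕ → Σ X : Type v, Digraph X
  | 0 => ⟨W, D⟩
  | n + 1 => ⟨(towerSigma D n).1 ⊕ (towerSigma D n).2.Extra, (towerSigma D n).2.step⟩

/-- The vertex type of the `n`-th iterate of `Digraph.step`. -/
abbrev Level (D : Digraph W) (n : ℕ) : Type v := (towerSigma D n).1

/-- The `n`-th iterate of `Digraph.step`. -/
abbrev tower (D : Digraph W) (n : ℕ) : Digraph (D.Level n) := (towerSigma D n).2

theorem IsLocally.tower (hD : Γ.IsLocally D) (n : ℕ) : Γ.IsLocally (D.tower n) := by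
  induction n with
  | zero => exact hD
  | succ n ih => exact ih.step

/-- The inclusion of a level of the tower into the next. -/
abbrev up (D : Digraph W) (n : ℕ) : (D.tower n).Adj ↪r (D.tower (n + 1)).Adj := (D.tower n).incl

/-- The vertices of the limit of the tower, sorted by the level at which they are added. -/
abbrev Limit (D : Digraph W) : Type v := W ⊕ Σ n, (D.tower n).Extra

/-- The inclusion of a level of the tower into the limit. -/
def toLimit (D : Digraph W) : (n : ℕ) → D.Level n → D.Limit
  | 0 => Sum.inl
  | n + 1 => Sum.elim (toLimit D n) fun p => .inr ⟨n, p⟩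

theorem toLimit_up (n : ℕ) (x : D.Level n) : D.toLimit (n + 1) (D.up n x) = D.toLimit n x := rfl

theorem toLimit_ne_inr {n m : ℕ} (h : n ≤ m) (x : D.Level n) (p : (D.tower m).Extra) :
    D.toLimit n x ≠ .inr ⟨m, p⟩ := by
  induction n with
  | zero => exact Sum.inl_ne_inr
  | succ n ih =>
    rcases x with x | q
    · exact ih (by omega) x
    · intro he
      have : n = m := congrArg Sigma.fst (Sum.inr_injective he)
      omega

theorem toLimit_injective (n : ℕ) : Function.Injective (D.toLimit n) := by
  induction n with
  | zero => exact Sum.inl_injective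
  | succ n ih =>
    rintro (x | p) (y | q) h
    · exact congrArg Sum.inl (ih h)
    · exact (toLimit_ne_inr le_rfl x q h).elim
    · exact (toLimit_ne_inr le_rfl y p h.symm).elim
    · cases Sum.inr_injective h
      rfl

theorem exists_lift {n m : ℕ} (h : n ≤ m) : ∃ i : (D.tower n).Adj ↪r (D.tower m).Adj,
    ∀ x, D.toLimit m (i x) = D.toLimit n x := by
  induction m, h using Nat.le_induction with
  | base => exact ⟨RelEmbedding.refl _, fun x => rfl⟩
  | succ m _ ih =>
    obtain ⟨i, hi⟩ := ih
    exact ⟨i.trans (D.up m), fun x => (toLimit_up m (i x)).trans (hi x)⟩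

theorem exists_eq_toLimit (a : D.Limit) : ∃ n x, D.toLimit n x = a := by
  rcases a with x | ⟨n, p⟩
  · exact ⟨0, x, rfl⟩
  · exact ⟨n + 1, .inr p, rfl⟩

/-- The limit of the tower. -/
def limit (D : Digraph W) : Digraph D.Limit where
  Adj a b := ∃ (n : ℕ) (x y : D.Level n),
    D.toLimit n x = a ∧ D.toLimit n y = b ∧ (D.tower n).Adj x y

/-- The embedding of a level of the tower into the limit. -/
def levelEmb (D : Digraph W) (n : ℕ) : (D.tower n).Adj ↪r D.limit.Adj :=
  ⟨⟨D.toLimit n, toLimit_injective n⟩, by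
    intro x y
    refine ⟨?_, fun h => ⟨n, x, y, rfl, rfl, h⟩⟩
    rintro ⟨m, x', y', hx, hy, h⟩
    obtain ⟨i, hi⟩ := exists_lift (D := D) (le_max_left n m)
    obtain ⟨i', hi'⟩ := exists_lift (D := D) (le_max_right n m)
    rw [← i.map_rel_iff]
    rw [← i'.map_rel_iff] at h
    have e1 : i' x' = i x := toLimit_injective _ ((hi' _).trans (hx.trans (hi _).symm))
    have e2 : i' y' = i y := toLimit_injective _ ((hi' _).trans (hy.trans (hi _).symm))
    rwa [e1, e2] at h⟩

theorem levelEmb_up (n : ℕ) (x : D.Level n) :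
    D.levelEmb (n + 1) (D.up n x) = D.levelEmb n x := rfl

theorem exists_eq_levelEmb (a : D.Limit) : ∃ n x, D.levelEmb n x = a := exists_eq_toLimit a

theorem range_levelEmb_mono : Monotone fun n => range (D.levelEmb n) := by
  refine monotone_nat_of_le_succ fun n => ?_
  rintro _ ⟨x, rfl⟩
  exact ⟨D.up n x, rfl⟩

theorem IsAsymmetric.limit (hD : ∀ n, (D.tower n).IsAsymmetric) : D.limit.IsAsymmetric := by
  intro a b h h'
  obtain ⟨n, x, hx⟩ := exists_eq_levelEmb a
  obtain ⟨m, y, hy⟩ := exists_eq_levelEmb b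
  obtain ⟨x, rfl⟩ := range_levelEmb_mono (le_max_left n m) ⟨x, hx⟩
  obtain ⟨y, rfl⟩ := range_levelEmb_mono (le_max_right n m) ⟨y, hy⟩
  exact hD _ _ _ ((D.levelEmb _).map_rel_iff.1 h) ((D.levelEmb _).map_rel_iff.1 h')

theorem isDescClosed_range_levelEmb (hD : ∀ n, (D.tower n).IsAsymmetric) (n : ℕ) :
    D.limit.IsDescClosed (range (D.levelEmb n)) := by
  rw [isDescClosed_iff (IsAsymmetric.limit hD)]
  have key : ∀ m, n ≤ m → ∀ x y, (D.tower m).Adj x y →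
      D.levelEmb m x ∈ range (D.levelEmb n) → D.levelEmb m y ∈ range (D.levelEmb n) := by
    intro m hm
    induction m, hm using Nat.le_induction with
    | base => exact fun x y _ _ => ⟨y, rfl⟩
    | succ m hm ih =>
      intro x y hxy hx
      obtain ⟨z, hz⟩ := range_levelEmb_mono hm hx
      obtain rfl : D.up m z = x := (D.levelEmb (m + 1)).injective ((levelEmb_up m z).trans hz)
      obtain ⟨y, rfl⟩ := (isDescClosed_iff (hD (m + 1))).1 (isDescClosed_range_incl (hD m)) _
        ⟨z, rfl⟩ y hxy
      exact ih z y ((D.up m).map_rel_iff.1 hxy) hx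
  rintro a ha b ⟨m, x, y, rfl, rfl, h⟩
  rcases le_total n m with hm | hm
  · exact key m hm x y h ha
  · exact range_levelEmb_mono hm ⟨y, rfl⟩

theorem isStrong_univ (hD : D.IsAsymmetric) : D.IsStrong univ where
  closed _ _ := subset_univ _
  mem_of_finite_diff _ _ := trivial
  finGen_inter b := by simpa using isFinGen_desc hD b

/-- A set which is strong in all sufficiently high levels is strong in the limit. -/
theorem isStrong_limit (hD : ∀ n, (D.tower n).IsAsymmetric) {A : Set D.Limit} (n : ℕ)
    (hA : ∀ m ≥ n, ∃ B, (D.tower m).IsStrong B ∧ D.levelEmb m '' B = A) : D.limit.IsStrong A := by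
  have hL := IsAsymmetric.limit hD
  have key : ∀ b : D.Limit, ((D.limit.desc b \ A).Finite → b ∈ A) ∧
      D.limit.IsFinGen (D.limit.desc b ∩ A) := by
    intro b
    obtain ⟨m, x, hx⟩ := exists_eq_levelEmb b
    obtain ⟨x, rfl⟩ := range_levelEmb_mono (le_max_right n m) ⟨x, hx⟩
    obtain ⟨B, hB, rfl⟩ := hA _ (le_max_left n m)
    have hcl := isDescClosed_range_levelEmb hD (max n m)
    rw [desc_apply _ hL hcl, ← image_inter (D.levelEmb _).injective, isFinGen_image_iff _ hL hcl,
      ← image_sdiff (D.levelEmb _).injective]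
    exact ⟨fun h => ⟨x, hB.mem_of_finite_diff x
      (h.of_finite_image (D.levelEmb _).injective.injOn), rfl⟩, hB.finGen_inter x⟩
  obtain ⟨B, hB, hBA⟩ := hA n le_rfl
  refine ⟨?_, fun b => (key b).1, fun b => (key b).2⟩
  rw [← hBA, isDescClosed_image_iff _ hL (isDescClosed_range_levelEmb hD n)]
  exact hB.closed

theorem isStrong_image_levelEmb (hD : ∀ n, (D.tower n).IsAsymmetric) (n : ℕ)
    {A : Set (D.Level n)} (hA : (D.tower n).IsStrong A) : D.limit.IsStrong (D.levelEmb n '' A) := by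
  refine isStrong_limit hD n fun m hm => ?_
  induction m, hm using Nat.le_induction with
  | base => exact ⟨A, hA, rfl⟩
  | succ m hm ih =>
    obtain ⟨B, hB, hBA⟩ := ih
    refine ⟨D.up m '' B, IsStrong.image _ (hD (m + 1)) (isStrong_range_incl (hD m)) hB, ?_⟩
    rw [← hBA, image_image]
    rfl

theorem isStrong_range_levelEmb (hD : ∀ n, (D.tower n).IsAsymmetric) (n : ℕ) :
    D.limit.IsStrong (range (D.levelEmb n)) := by
  rw [← image_univ]
  exact isStrong_image_levelEmb hD n (isStrong_univ (hD n))

theorem IsLocally.limit (hD : Γ.IsLocally D) : Γ.IsLocally D.limit := by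
  have has := fun n => (hD.tower n).asymm
  have hL := IsAsymmetric.limit has
  have key : ∀ a, (∃ θ : Γ.Adj ↪r D.limit.Adj, range θ = D.limit.desc a) ∧
      D.limit.IsStrong (D.limit.desc a) := by
    intro a
    obtain ⟨n, x, rfl⟩ := exists_eq_levelEmb a
    rw [desc_apply _ hL (isDescClosed_range_levelEmb has n)]
    refine ⟨?_, isStrong_image_levelEmb has n ((hD.tower n).strong x)⟩
    obtain ⟨θ, hθ⟩ := (hD.tower n).exists_embedding x
    exact ⟨θ.trans (D.levelEmb n), by rw [← hθ, ← range_comp]; rfl⟩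
  exact ⟨hL, fun a => (key a).1, fun a => (key a).2⟩

theorem exists_undo_sequence (hD : ∀ n, (D.tower n).IsAsymmetric) (n : ℕ)
    (h : (D.tower n).Adj ↪r (D.tower (n + 1)).Adj) (hs : (D.tower (n + 1)).IsStrong (range h)) :
    ∃ f : ∀ k, (D.tower (n + k)).Adj ↪r (D.tower (n + k + 1)).Adj, f 0 = h ∧
      ∀ k x, f (k + 1) (f k x) = D.up (n + k + 1) (D.up (n + k) x) := by
  have hex : ∀ k (g : {g : (D.tower (n + k)).Adj ↪r (D.tower (n + k + 1)).Adj //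
      (D.tower (n + k + 1)).IsStrong (range g)}),
      ∃ g' : {g : (D.tower (n + (k + 1))).Adj ↪r (D.tower (n + (k + 1) + 1)).Adj //
        (D.tower (n + (k + 1) + 1)).IsStrong (range g)},
        ∀ x, g'.1 (g.1 x) = D.up (n + k + 1) (D.up (n + k) x) := by
    intro k g
    obtain ⟨g', hg', he⟩ := exists_undo (hD (n + k)) g.1 g.2
    exact ⟨⟨g', hg'⟩, he⟩
  choose next hnext using hex
  let f : ∀ k, {g : (D.tower (n + k)).Adj ↪r (D.tower (n + k + 1)).Adj //
      (D.tower (n + k + 1)).IsStrong (range g)} := fun k => Nat.rec ⟨h, hs⟩ (fun k g => next k g) k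
  exact ⟨fun k => (f k).1, rfl, fun k => hnext k (f k)⟩

/-- Modulo the inclusions, the maps of even index extend one another and their union is the
automorphism; those of odd index approximate its inverse. -/
theorem exists_aut_of_sequence {n : ℕ}
    (f : ∀ k, (D.tower (n + k)).Adj ↪r (D.tower (n + k + 1)).Adj)
    (hf : ∀ k x, f (k + 1) (f k x) = D.up (n + k + 1) (D.up (n + k) x)) :
    ∃ g : D.limit.Aut, ∀ x, g (D.levelEmb n x) = D.levelEmb (n + 1) (f 0 x) := by
  let R : ℕ → D.Limit → D.Limit → Prop := fun k a b =>
    ∃ x : D.Level (n + 2 * k), D.levelEmb _ x = a ∧ D.levelEmb _ (f (2 * k) x) = b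
  have hsucc : ∀ k a b, R k a b → R (k + 1) a b := by
    rintro k _ _ ⟨x, rfl, rfl⟩
    refine ⟨D.up (n + 2 * k + 1) (D.up (n + 2 * k) x), rfl, ?_⟩
    have h1 := hf (2 * k) x
    have h2 := hf (2 * k + 1) (f (2 * k) x)
    rw [h1] at h2
    exact congrArg (D.levelEmb (n + 2 * k + 3)) h2
  have hmono : ∀ k l, k ≤ l → ∀ a b, R k a b → R l a b := by
    intro k l hkl
    induction l, hkl using Nat.le_induction with
    | base => exact fun _ _ h => h
    | succ l _ ih => exact fun a b h => hsucc l a b (ih a b h)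
  have hcover : ∀ a : D.Limit, ∃ k x, D.levelEmb (n + k) x = a := by
    intro a
    obtain ⟨k, x, hx⟩ := exists_eq_levelEmb a
    obtain ⟨y, hy⟩ := range_levelEmb_mono (Nat.le_add_left k n) ⟨x, hx⟩
    exact ⟨k, y, hy⟩
  have htotal : ∀ a, ∃ b k, R k a b := by
    intro a
    obtain ⟨k, x, hx⟩ := hcover a
    obtain ⟨y, hy⟩ := range_levelEmb_mono (show n + k ≤ n + 2 * k by omega) ⟨x, hx⟩
    exact ⟨_, k, y, hy, rfl⟩
  -- A preimage is the value of an odd-index map, which the following even-index map undoes.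
  have hsurj : ∀ b, ∃ a k, R k a b := by
    intro b
    obtain ⟨k, x, hx⟩ := hcover b
    obtain ⟨y, hy⟩ := range_levelEmb_mono (show n + k ≤ n + 2 * k + 1 by omega) ⟨x, hx⟩
    refine ⟨_, k + 1, f (2 * k + 1) y, rfl, ?_⟩
    rw [← hy]
    exact congrArg (D.levelEmb (n + 2 * k + 3)) (hf (2 * k + 1) y)
  have hadj : ∀ k l a b a' b', R k a b → R l a' b' →
      (D.limit.Adj b b' ↔ D.limit.Adj a a') ∧ (b = b' ↔ a = a') := by
    intro k l a b a' b' h h'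
    obtain ⟨x, rfl, rfl⟩ := hmono _ _ (le_max_left k l) _ _ h
    obtain ⟨y, rfl, rfl⟩ := hmono _ _ (le_max_right k l) _ _ h'
    simp only [RelEmbedding.map_rel_iff, RelEmbedding.inj]
    exact ⟨trivial, trivial⟩
  choose g k hg using htotal
  have hbij : Function.Bijective g := by
    refine ⟨fun a a' h => (hadj _ _ _ _ _ _ (hg a) (hg a')).2.1 h, fun b => ?_⟩
    obtain ⟨a, l, h⟩ := hsurj b
    exact ⟨a, (hadj _ _ _ _ _ _ (hg a) h).2.2 rfl⟩
  refine ⟨⟨Equiv.ofBijective g hbij, fun {a a'} => (hadj _ _ _ _ _ _ (hg a) (hg a')).1⟩, ?_⟩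
  intro x
  have h0 : R 0 (D.levelEmb n x) (D.levelEmb (n + 1) (f 0 x)) := ⟨x, rfl, rfl⟩
  exact (hadj _ _ _ _ _ _ (hg _) h0).2.2 rfl

end Limit

/-- A filtration of `D` by strong sets such that partial isomorphisms of each of the sets extend
to automorphisms of `D` in a free way. -/
structure IsFreeFiltration {W : Type v} (D : Digraph W) (S : ℕ → Set W) : Prop where
  mono : Monotone S
  exists_mem : ∀ a, ∃ n, a ∈ S n
  strong : ∀ n, D.IsStrong (S n)
  exists_aut : ∀ (n : ℕ) (φ : D.PartialIso), φ.dom ⊆ S n → φ.toFun '' φ.dom ⊆ S n →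
    ∃ g : D.Aut, (∀ x ∈ φ.dom, g x = φ.toFun x) ∧ (∀ x ∈ S n, g x ∈ S n → x ∈ φ.dom) ∧
      g '' S n ⊆ S (n + 1) ∧ ∀ c ∈ S (n + 1), c ∉ g '' S n → D.desc c ∩ g '' S n ⊆ S n

theorem IsLocally.isFreeFiltration_limit {V : Type u} {W : Type v} {Γ : Digraph V} {D : Digraph W}
    (hD : Γ.IsLocally D) : D.limit.IsFreeFiltration fun n => range (D.levelEmb n) where
  mono := range_levelEmb_mono
  exists_mem := exists_eq_levelEmb
  strong := isStrong_range_levelEmb fun n => (hD.tower n).asymm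
  exists_aut n φ hdom hran := by
    have has := fun n => (hD.tower n).asymm
    have hL := IsAsymmetric.limit has
    have hcl := isDescClosed_range_levelEmb has n
    have hdom' : D.levelEmb n '' (D.levelEmb n ⁻¹' φ.dom) = φ.dom :=
      image_preimage_eq_of_subset hdom
    have hex : ∀ x : D.Level n, ∃ y, D.levelEmb n x ∈ φ.dom →
        D.levelEmb n y = φ.toFun (D.levelEmb n x) := by
      intro x
      by_cases hx : D.levelEmb n x ∈ φ.dom
      · obtain ⟨y, hy⟩ := hran ⟨_, hx, rfl⟩
        exact ⟨y, fun _ => hy⟩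
      · exact ⟨x, fun h => (hx h).elim⟩
    choose t ht using hex
    -- The partial isomorphism pulled back to level `n`; its own copy in level `n + 1` starts the
    -- back-and-forth, and freeness of the amalgam gives freeness of the automorphism.
    let ψ : (D.tower n).PartialIso :=
      { dom := D.levelEmb n ⁻¹' φ.dom
        toFun := t
        injOn := by
          intro x hx y hy he
          refine (D.levelEmb n).injective (φ.injOn hx hy ?_)
          rw [← ht x hx, ← ht y hy, he]
        adj_iff := by
          intro x hx y hy
          rw [← (D.levelEmb n).map_rel_iff, ht x hx, ht y hy, φ.adj_iff _ hx _ hy,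
            (D.levelEmb n).map_rel_iff]
        strong_dom := IsStrong.of_image (D.levelEmb n) hL hcl (hdom'.symm ▸ φ.strong_dom)
        strong_image := by
          refine IsStrong.of_image (D.levelEmb n) hL hcl ?_
          convert φ.strong_image using 1
          rw [image_image]
          conv_rhs => rw [← hdom', image_image]
          exact image_congr fun x hx => ht x hx }
    obtain ⟨c, hcs, hcmem, hceq, hcdesc⟩ : ∃ c : (D.tower n).Adj ↪r (D.tower (n + 1)).Adj,
        (D.tower (n + 1)).IsStrong (range c) ∧ (∀ x ∈ ψ.dom, c x = D.up n (t x)) ∧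
        (∀ x y, c x = D.up n y → x ∈ ψ.dom) ∧
        ∀ b ∉ range c, (D.tower (n + 1)).desc b ∩ range c ⊆ range (D.up n) :=
      ⟨copy (has n) ψ, isStrong_range_copy (has n) ψ, fun x hx => copy_of_mem (has n) ψ hx,
        fun x y h => (copy_eq_incl (has n) ψ h).1, fun b hb => desc_inter_range_copy (has n) ψ hb⟩
    obtain ⟨f, rfl, hf⟩ := exists_undo_sequence has n c hcs
    obtain ⟨g, hg⟩ := exists_aut_of_sequence f hf
    have hgim : g '' range (D.levelEmb n) = D.levelEmb (n + 1) '' range (f 0) := by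
      ext a
      constructor
      · rintro ⟨_, ⟨x, rfl⟩, rfl⟩
        exact ⟨_, ⟨x, rfl⟩, (hg x).symm⟩
      · rintro ⟨_, ⟨x, rfl⟩, rfl⟩
        exact ⟨_, ⟨x, rfl⟩, hg x⟩
    refine ⟨g, ?_, ?_, ?_, ?_⟩
    · intro a ha
      obtain ⟨x, rfl⟩ := hdom ha
      rw [hg, ← ht x ha]
      exact congrArg (D.levelEmb (n + 1)) (hcmem x ha)
    · rintro _ ⟨x, rfl⟩ ⟨y, hy⟩
      rw [hg, ← levelEmb_up] at hy
      exact hceq x y ((D.levelEmb (n + 1)).injective hy).symm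
    · rw [hgim]
      exact image_subset_range _ _
    · rintro _ ⟨b, rfl⟩ hb
      rw [hgim] at hb ⊢
      have hb' : b ∉ range (f 0) := fun h => hb ⟨b, h, rfl⟩
      rw [desc_apply _ hL (isDescClosed_range_levelEmb has (n + 1))]
      rintro _ ⟨⟨y, hy, rfl⟩, z, hz, hzy⟩
      obtain rfl := (D.levelEmb (n + 1)).injective hzy
      obtain ⟨w, rfl⟩ := hcdesc b hb' ⟨hy, hz⟩
      exact ⟨w, rfl⟩

/-! ### Distance transitivity, in-valency and primitivity from a free filtration. -/

section Homogeneous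

variable {V : Type u} {W : Type v} {Γ : Digraph V} {γ : V} {D : Digraph W} {S : ℕ → Set W}

theorem desc_aut (hD : D.IsAsymmetric) (g : D.Aut) (x : W) : D.desc (g x) = g '' D.desc x :=
  desc_apply g.toRelEmbedding hD (fun _ _ _ _ => g.surjective _) x

theorem IsFreeFiltration.exists_subset (hS : D.IsFreeFiltration S) {X : Set W} (hX : X.Finite) :
    ∃ n, X ⊆ S n := by
  induction X, hX using Set.Finite.induction_on with
  | empty => exact ⟨0, empty_subset _⟩
  | @insert a X _ _ ih =>
    obtain ⟨n, hn⟩ := ih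
    obtain ⟨m, hm⟩ := hS.exists_mem a
    exact ⟨max n m, insert_subset (hS.mono (le_max_right n m) hm)
      (hn.trans (hS.mono (le_max_left n m)))⟩

theorem IsFreeFiltration.exists_aut_extending (hS : D.IsFreeFiltration S) {X : Type w}
    {E : Digraph X} (i i' : E.Adj ↪r D.Adj) (hi : D.IsStrong (range i))
    (hi' : D.IsStrong (range i')) {n : ℕ} (hin : range i ⊆ S n) (hin' : range i' ⊆ S n) :
    ∃ g : D.Aut, (∀ x, g (i x) = i' x) ∧ (∀ x ∈ S n, g x ∈ S n → x ∈ range i) ∧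
      g '' S n ⊆ S (n + 1) ∧ ∀ c ∈ S (n + 1), c ∉ g '' S n → D.desc c ∩ g '' S n ⊆ S n := by
  obtain ⟨φ, hφ, hφ'⟩ := exists_partialIso i i' hi hi'
  obtain ⟨g, h1, h2, h3⟩ := hS.exists_aut n φ (hφ ▸ hin) (by
    rw [hφ]
    rintro _ ⟨_, ⟨x, rfl⟩, rfl⟩
    rw [hφ']
    exact hin' (mem_range_self x))
  rw [hφ] at h1 h2
  exact ⟨g, fun x => (h1 _ (mem_range_self x)).trans (hφ' x), h2, h3⟩

theorem HasWalk.of_apply (hD : D.IsAsymmetric) (θ : Γ.Adj ↪r D.Adj)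
    (hθ : D.IsDescClosed (range θ)) {n : ℕ} {x : V} {z : W} (h : D.HasWalk n (θ x) z) :
    ∃ y, θ y = z ∧ Γ.HasWalk n x y := by
  induction n generalizing z with
  | zero => exact ⟨x, h, rfl⟩
  | succ n ih =>
    obtain ⟨w, hw, hwz⟩ := h
    obtain ⟨y, rfl, hy⟩ := ih hw
    obtain ⟨z, rfl⟩ := (isDescClosed_iff hD).1 hθ _ ⟨y, rfl⟩ _ hwz
    exact ⟨z, rfl, y, hy, θ.map_rel_iff.1 hwz⟩

/-- Automorphisms extending the identification of two descendant sets with `Γ`. -/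
theorem IsFreeFiltration.exists_aut_desc (hD : Γ.IsLocally D) (hS : D.IsFreeFiltration S)
    {a b : W} {n : ℕ} (ha : a ∈ S n) (hb : b ∈ S n) {θ κ : Γ.Adj ↪r D.Adj}
    (hθ : range θ = D.desc a) (hκ : range κ = D.desc b) :
    ∃ g : D.Aut, (∀ x, g (θ x) = κ x) ∧ (∀ x ∈ S n, g x ∈ S n → x ∈ D.desc a) ∧
      g '' S n ⊆ S (n + 1) ∧ ∀ c ∈ S (n + 1), c ∉ g '' S n → D.desc c ∩ g '' S n ⊆ S n := by
  have := hS.exists_aut_extending θ κ (hθ ▸ hD.strong a) (hκ ▸ hD.strong b)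
    (hθ ▸ (hS.strong n).closed a ha) (hκ ▸ (hS.strong n).closed b hb)
  rwa [hθ] at this

theorem IsFreeFiltration.exists_aut_of_hasWalk (hΓ : Γ.IsAsymmetric) (h0 : Γ.P0 γ) (h3 : Γ.P3 γ)
    (hD : Γ.IsLocally D) (hS : D.IsFreeFiltration S) {s : ℕ} {u v u' v' : W}
    (h : D.HasWalk s u v) (h' : D.HasWalk s u' v') : ∃ g : D.Aut, g u = u' ∧ g v = v' := by
  obtain ⟨θ, hθ⟩ := hD.exists_embedding u
  obtain ⟨κ, hκ⟩ := hD.exists_embedding u'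
  have hθγ := embedding_apply_root hΓ h0 hD.asymm hθ
  have hκγ := embedding_apply_root hΓ h0 hD.asymm hκ
  rw [← hθγ] at h
  rw [← hκγ] at h'
  obtain ⟨x, rfl, hx⟩ := h.of_apply hD.asymm θ (hθ ▸ isDescClosed_desc hD.asymm u)
  obtain ⟨y, rfl, hy⟩ := h'.of_apply hD.asymm κ (hκ ▸ isDescClosed_desc hD.asymm u')
  obtain ⟨α, rfl⟩ := h3 s x ((mem_layer_iff hΓ).2 hx) y ((mem_layer_iff hΓ).2 hy)
  obtain ⟨n, hn⟩ := hS.exists_subset (X := {u, u'}) (by simp)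
  have hκ' : range (α.toRelEmbedding.trans κ) = D.desc u' := by
    rw [← hκ]
    exact α.surjective.range_comp κ
  obtain ⟨g, hg, -⟩ := hS.exists_aut_desc hD (hn (by simp)) (hn (by simp)) hθ hκ'
  refine ⟨g, ?_, hg x⟩
  rw [← hθγ, hg γ, ← hκγ]
  exact congrArg κ (h0.aut_root hΓ α)

theorem IsFreeFiltration.infinite_inSet (hΓ : Γ.IsAsymmetric) (h0 : Γ.P0 γ) (h3 : Γ.P3 γ)
    (hD : Γ.IsLocally D) (hS : D.IsFreeFiltration S) (a : W) : (D.inSet a).Infinite := by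
  obtain ⟨θ, hθ⟩ := hD.exists_embedding a
  have hθγ := embedding_apply_root hΓ h0 hD.asymm hθ
  obtain ⟨e, he⟩ : ∃ e, D.Adj e a := by
    obtain ⟨x, hx⟩ := h0.exists_adj γ
    obtain ⟨g, hg, -⟩ := hS.exists_aut_of_hasWalk hΓ h0 h3 hD (s := 0) (u := θ x) (u' := a) rfl rfl
    exact ⟨g (θ γ), by rw [← hg, g.map_rel_iff, θ.map_rel_iff]; exact hx⟩
  intro hfin
  obtain ⟨n, hn⟩ := hS.exists_subset (hfin.insert a)
  have han := hn (mem_insert _ _)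
  -- `g` fixes `a` and therefore permutes its in-vertices, all of which lie in `S n`; freeness then
  -- puts `e` among the descendants of `a`, creating a cycle.
  obtain ⟨g, hg, hfree, -⟩ := hS.exists_aut_desc hD han han hθ hθ
  have hga : g a = a := by
    rw [← hθγ]
    exact hg γ
  have hge : D.Adj (g e) a := by
    rw [← hga, g.map_rel_iff]
    exact he
  have h1 := hfree e (hn (mem_insert_of_mem _ he)) (hn (mem_insert_of_mem _ hge))
  have h2 := hD.antisymm hΓ h0 h1 ((mem_desc_iff hD.asymm).2 (.single he))
  subst h2
  exact hD.asymm _ _ he he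

/-- The disjoint union of two copies of `Γ`. -/
def double (Γ : Digraph V) : Digraph (V ⊕ V) where
  Adj
    | .inl x, .inl y => Γ.Adj x y
    | .inr x, .inr y => Γ.Adj x y
    | _, _ => False

theorem exists_double_embedding (hD : D.IsAsymmetric) {θ κ : Γ.Adj ↪r D.Adj}
    (hθ : D.IsDescClosed (range θ)) (hκ : D.IsDescClosed (range κ))
    (hdisj : Disjoint (range θ) (range κ)) :
    ∃ i : Γ.double.Adj ↪r D.Adj, (∀ x, i (.inl x) = θ x) ∧ ∀ x, i (.inr x) = κ x := by
  have hne : ∀ x y, θ x ≠ κ y := fun x y h =>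
    disjoint_left.1 hdisj (mem_range_self x) (h ▸ mem_range_self y)
  refine ⟨⟨⟨Sum.elim θ κ, θ.injective.sumElim κ.injective hne⟩, ?_⟩,
    fun _ => rfl, fun _ => rfl⟩
  rintro (x | x) (y | y)
  · exact θ.map_rel_iff
  · refine ⟨fun h => ?_, False.elim⟩
    exact disjoint_right.1 hdisj ⟨y, rfl⟩ ((isDescClosed_iff hD).1 hθ _ ⟨x, rfl⟩ _ h)
  · refine ⟨fun h => ?_, False.elim⟩
    exact disjoint_left.1 hdisj ⟨y, rfl⟩ ((isDescClosed_iff hD).1 hκ _ ⟨x, rfl⟩ _ h)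
  · exact κ.map_rel_iff

/-- Two vertices whose descendant sets are disjoint and form a strong set. -/
def AreFree (D : Digraph W) (a b : W) : Prop :=
  Disjoint (D.desc a) (D.desc b) ∧ D.IsStrong (D.desc a ∪ D.desc b)

/-- Closed disjoint sets have no edges between them, so both unions are strong copies of `Γ.double`
and the identification extends. -/
theorem IsFreeFiltration.exists_aut_of_areFree (hΓ : Γ.IsAsymmetric) (h0 : Γ.P0 γ)
    (hD : Γ.IsLocally D) (hS : D.IsFreeFiltration S) {a b a' b' : W}
    (h : D.AreFree a b) (h' : D.AreFree a' b') : ∃ g : D.Aut, g a = a' ∧ g b = b' := by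
  have key : ∀ a b, D.AreFree a b → ∃ i : Γ.double.Adj ↪r D.Adj,
      i (.inl γ) = a ∧ i (.inr γ) = b ∧ range i = D.desc a ∪ D.desc b := by
    rintro a b ⟨hdisj, -⟩
    obtain ⟨θ, hθ⟩ := hD.exists_embedding a
    obtain ⟨κ, hκ⟩ := hD.exists_embedding b
    obtain ⟨i, hil, hir⟩ := exists_double_embedding hD.asymm
      (hθ ▸ isDescClosed_desc hD.asymm a) (hκ ▸ isDescClosed_desc hD.asymm b) (hθ ▸ hκ ▸ hdisj)
    refine ⟨i, ?_, ?_, ?_⟩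
    · rw [hil, embedding_apply_root hΓ h0 hD.asymm hθ]
    · rw [hir, embedding_apply_root hΓ h0 hD.asymm hκ]
    · rw [← hθ, ← hκ]
      ext y
      simp only [mem_range, Sum.exists, hil, hir, mem_union]
  obtain ⟨i, rfl, rfl, hi⟩ := key a b h
  obtain ⟨i', rfl, rfl, hi'⟩ := key a' b' h'
  obtain ⟨n, hn⟩ := hS.exists_subset
    (X := {i (.inl γ), i (.inr γ), i' (.inl γ), i' (.inr γ)}) (by simp)
  have hcl := (hS.strong n).closed
  obtain ⟨g, hg, -⟩ := hS.exists_aut_extending i i' (hi ▸ h.2) (hi' ▸ h'.2) (n := n)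
    (hi ▸ union_subset (hcl _ (hn (by simp))) (hcl _ (hn (by simp))))
    (hi' ▸ union_subset (hcl _ (hn (by simp))) (hcl _ (hn (by simp))))
  exact ⟨g, hg _, hg _⟩

/-- A union of strong sets can fail condition (i) when a descendant set is covered, up to finitely
many vertices, only by both together; the hypothesis `h` excludes this. -/
theorem IsStrong.union_of_disjoint {S A B : Set W} (hS : D.IsStrong S) (hA : D.IsStrong A)
    (hB : D.IsStrong B) (hAS : A ⊆ S) (hBS : B ⊆ S)
    (h : ∀ c ∈ S, D.desc c ∩ A = ∅ ∨ D.desc c ∩ B = ∅) : D.IsStrong (A ∪ B) := by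
  refine hS.trans (union_subset hAS hBS) (hA.closed.union hB.closed) ?_ ?_
  · intro c hc hfin
    rcases h c hc with h | h
    · refine .inr (hB.mem_of_finite_diff c ?_)
      rwa [← sdiff_self_inter, inter_union_distrib_left, h, empty_union, sdiff_self_inter] at hfin
    · refine .inl (hA.mem_of_finite_diff c ?_)
      rwa [← sdiff_self_inter, inter_union_distrib_left, h, union_empty, sdiff_self_inter] at hfin
  · intro c hc
    rw [inter_union_distrib_left]
    exact (hA.finGen_inter c).union (hB.finGen_inter c)

theorem IsFreeFiltration.areFree (hD : Γ.IsLocally D) (hS : D.IsFreeFiltration S) {n : ℕ}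
    {B : Set W} {g : D.Aut} (hfree : ∀ x ∈ S n, g x ∈ S n → x ∈ B) (hsub : g '' S n ⊆ S (n + 1))
    (hdesc : ∀ c ∈ S (n + 1), c ∉ g '' S n → D.desc c ∩ g '' S n ⊆ S n) {p q : W}
    (hp : p ∈ S n) (hq : q ∈ S n) (hqB : Disjoint (D.desc q) B)
    (hpB : Disjoint (D.desc p) (g '' B)) : D.AreFree p (g q) := by
  have hcl := (hS.strong n).closed
  have hdisj : Disjoint (S n) (D.desc (g q)) := by
    rw [disjoint_right, desc_aut hD.asymm]
    rintro _ ⟨c, hc, rfl⟩ hy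
    exact disjoint_left.1 hqB hc (hfree c (hcl q hq hc) hy)
  refine ⟨hdisj.mono_left (hcl p hp), (hS.strong (n + 1)).union_of_disjoint (hD.strong p)
    (hD.strong _) ((hcl p hp).trans (hS.mono n.le_succ)) ?_ ?_⟩
  · exact (hS.strong (n + 1)).closed _ (hsub ⟨q, hq, rfl⟩)
  · intro c hc
    -- Below a vertex of `g '' S n`, vertices of `S n` lie in `g '' B`, which misses `D.desc p`;
    -- below any other vertex, those of `g '' S n` lie in `S n`, which misses `D.desc (g q)`.
    by_cases hcg : c ∈ g '' S n
    · left
      obtain ⟨c, hc', rfl⟩ := hcg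
      refine eq_empty_of_forall_notMem ?_
      rintro y ⟨hy, hyp⟩
      rw [desc_aut hD.asymm] at hy
      obtain ⟨y, hy, rfl⟩ := hy
      exact disjoint_left.1 hpB hyp ⟨y, hfree y (hcl c hc' hy) (hcl p hp hyp), rfl⟩
    · right
      refine eq_empty_of_forall_notMem ?_
      rintro y ⟨hy, hyq⟩
      refine disjoint_right.1 hdisj hyq (hdesc c hc hcg ⟨hy, ?_⟩)
      rw [desc_aut hD.asymm] at hyq
      exact image_mono (hcl q hq) hyq

/-- A non-trivial invariant equivalence relation relates two vertices with disjoint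
descendant sets. -/
theorem IsFreeFiltration.exists_disjoint (hΓ : Γ.IsAsymmetric) (h0 : Γ.P0 γ) (h3 : Γ.P3 γ)
    (hD : Γ.IsLocally D) (hS : D.IsFreeFiltration S) {r : W → W → Prop} (hr : Equivalence r)
    (hinv : ∀ (g : D.Aut) x y, r x y → r (g x) (g y)) {a b : W} (hab : r a b)
    (hb : b ∉ D.desc a) : ∃ p q, r p q ∧ Disjoint (D.desc p) (D.desc q) := by
  have hcl := fun n => (hS.strong n).closed
  -- Requiring `θ` and `κ` to agree on `Z` makes the intersection occupy the same place in both
  -- copies of `Γ`, so that such pairs can be chained.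
  let 𝒮 : Set (Set V) := {Z | ∃ (p q : W) (θ κ : Γ.Adj ↪r D.Adj), r p q ∧
    range θ = D.desc p ∧ range κ = D.desc q ∧ (∀ x ∈ Z, θ x = κ x) ∧
    D.desc p ∩ D.desc q = θ '' Z}
  suffices h : ∅ ∈ 𝒮 by
    obtain ⟨p, q, θ, κ, hpq, -, -, -, h⟩ := h
    exact ⟨p, q, hpq, disjoint_iff_inter_eq_empty.2 (by rw [h, image_empty])⟩
  obtain ⟨Z, hZ, hfg, hinf⟩ : ∃ Z ∈ 𝒮, Γ.IsFinGen Z ∧ Zᶜ.Infinite := by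
    obtain ⟨n, hn⟩ := hS.exists_subset (X := {a, b}) (by simp)
    have han : a ∈ S n := hn (by simp)
    have hbn : b ∈ S n := hn (by simp)
    obtain ⟨θ, hθ⟩ := hD.exists_embedding a
    obtain ⟨κ, hκ⟩ := hD.exists_embedding b
    -- With `D.desc a` fixed pointwise, `b` and `g b` are both related to `a` and their descendant
    -- sets meet exactly inside `D.desc a`. P2 makes this intersection finitely generated, with
    -- infinite complement as `b ∉ D.desc a`.
    obtain ⟨g, hg, hfree, -⟩ := hS.exists_aut_desc hD han han hθ hθ
    have hfix : ∀ x ∈ D.desc a, g x = x := by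
      rw [← hθ]
      rintro _ ⟨x, rfl⟩
      exact hg x
    have him : κ '' (κ ⁻¹' D.desc a) = D.desc b ∩ D.desc a := by
      rw [image_preimage_eq_range_inter, hκ]
    refine ⟨κ ⁻¹' D.desc a, ⟨b, g b, κ, κ.trans g.toRelEmbedding, ?_, hκ, ?_, ?_, ?_⟩, ?_, ?_⟩
    · refine hr.trans (hr.symm hab) ?_
      have := hinv g a b hab
      rwa [hfix a (self_mem_desc hD.asymm a)] at this
    · rw [desc_aut hD.asymm, ← hκ, ← range_comp]
      rfl
    · exact fun x hx => (hfix _ hx).symm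
    · rw [him, desc_aut hD.asymm]
      ext y
      constructor
      · rintro ⟨hy, c, hc, rfl⟩
        have := hfree c (hcl n b hbn hc) (hcl n b hbn hy)
        refine ⟨hy, ?_⟩
        rwa [hfix c this]
      · rintro ⟨hy, hya⟩
        exact ⟨hy, y, hy, hfix y hya⟩
    · rw [← isFinGen_image_iff κ hD.asymm (hκ ▸ isDescClosed_desc hD.asymm b), him]
      exact (hD.strong a).finGen_inter b
    · intro hfin
      refine hb ((hD.strong a).mem_of_finite_diff b ((hfin.image κ).subset ?_))
      rw [← hκ]
      rintro _ ⟨⟨x, rfl⟩, hx⟩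
      exact ⟨x, hx, rfl⟩
  refine h0.empty_mem hΓ h3 ?_ ?_ hZ hfg hinf
  · rintro g Z ⟨p, q, θ, κ, hpq, hθ, hκ, hZ, hinter⟩
    refine ⟨p, q, g.symm.toRelEmbedding.trans θ, g.symm.toRelEmbedding.trans κ, hpq, ?_, ?_, ?_, ?_⟩
    · rw [← hθ]
      exact g.symm.surjective.range_comp θ
    · rw [← hκ]
      exact g.symm.surjective.range_comp κ
    · rintro _ ⟨x, hx, rfl⟩
      simpa using hZ x hx
    · rw [hinter, image_image]
      exact image_congr fun x _ => by simp
  · rintro Y ⟨p, p', θ, θ', hp, hθ, hθ', hY, hpp⟩ Z ⟨q, q', κ, κ', hq, hκ, hκ', hZ, hqq⟩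
    obtain ⟨n, hn⟩ := hS.exists_subset (X := {p, p', q, q'}) (by simp)
    have hp'n : p' ∈ S n := hn (by simp)
    have hq'n : q' ∈ S n := hn (by simp)
    -- Gluing the second pair to the first along `q ↦ p` relates `p'` to `g q'`, and by freeness
    -- their descendant sets meet only inside `D.desc p`, in the part coming from `Y ∩ Z`.
    obtain ⟨g, hg, hfree, -⟩ := hS.exists_aut_desc hD (hn (by simp)) (hn (by simp)) hκ hθ
    have hgq : g q = p := by
      rw [← embedding_apply_root hΓ h0 hD.asymm hκ, hg, embedding_apply_root hΓ h0 hD.asymm hθ]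
    refine ⟨p', g q', θ', κ'.trans g.toRelEmbedding, ?_, hθ', ?_, ?_, ?_⟩
    · refine hr.trans (hr.symm hp) ?_
      rw [← hgq]
      exact hinv g _ _ hq
    · rw [desc_aut hD.asymm, ← hκ', ← range_comp]
      rfl
    · intro x hx
      rw [← hY x hx.1, ← hg x, hZ x hx.2]
      rfl
    · rw [desc_aut hD.asymm]
      ext y
      constructor
      · rintro ⟨hy, c, hc, rfl⟩
        have hcq := hfree c (hcl n q' hq'n hc) (hcl n p' hp'n hy)
        obtain ⟨z, hz, rfl⟩ : c ∈ κ '' Z := hqq ▸ ⟨hcq, hc⟩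
        rw [hg] at hy ⊢
        obtain ⟨z', hz', he⟩ : θ z ∈ θ '' Y := hpp ▸ ⟨hθ ▸ mem_range_self z, hy⟩
        obtain rfl := θ.injective he
        exact ⟨z', ⟨hz', hz⟩, (hY z' hz').symm⟩
      · rintro ⟨z, ⟨hzY, hzZ⟩, rfl⟩
        refine ⟨hθ' ▸ mem_range_self z, κ' z, hκ' ▸ mem_range_self z, ?_⟩
        rw [← hZ z hzZ, hg, hY z hzY]

/-- A non-trivial invariant equivalence relation is universal. -/
theorem IsFreeFiltration.rel_of_ne (hΓ : Γ.IsAsymmetric) (h0 : Γ.P0 γ) (h3 : Γ.P3 γ)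
    (hD : Γ.IsLocally D) (hS : D.IsFreeFiltration S) {r : W → W → Prop} (hr : Equivalence r)
    (hinv : ∀ (g : D.Aut) x y, r x y → r (g x) (g y)) {a b : W} (hne : a ≠ b) (hab : r a b)
    (u v : W) : r u v := by
  obtain ⟨p, q, hpq, hdisj⟩ : ∃ p q, r p q ∧ Disjoint (D.desc p) (D.desc q) := by
    by_cases hb : b ∈ D.desc a
    · refine hS.exists_disjoint hΓ h0 h3 hD hr hinv (hr.symm hab) fun ha => hne ?_
      exact hD.antisymm hΓ h0 ha hb
    · exact hS.exists_disjoint hΓ h0 h3 hD hr hinv hab hb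
  obtain ⟨x, y, hxy, hfr⟩ : ∃ x y, r x y ∧ D.AreFree x y := by
    obtain ⟨n, hn⟩ := hS.exists_subset (X := {p, q}) (by simp)
    have hpn : p ∈ S n := hn (by simp)
    obtain ⟨θ, hθ⟩ := hD.exists_embedding p
    obtain ⟨g, hg, hfree, hsub, hdesc⟩ := hS.exists_aut_desc hD hpn hpn hθ hθ
    have hfix : ∀ x ∈ D.desc p, g x = x := by
      rw [← hθ]
      rintro _ ⟨x, rfl⟩
      exact hg x
    -- `q` and `g q` are both related to the fixed vertex `p`.
    refine ⟨q, g q, ?_, hS.areFree hD hfree hsub hdesc (hn (by simp)) (hn (by simp)) hdisj.symm ?_⟩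
    · refine hr.trans (hr.symm hpq) ?_
      have := hinv g _ _ hpq
      rwa [hfix p (self_mem_desc hD.asymm p)] at this
    · rw [image_congr hfix, image_id']
      exact hdisj.symm
  have hall : ∀ u w, D.AreFree u w → r u w := by
    intro u w h
    obtain ⟨g, rfl, rfl⟩ := hS.exists_aut_of_areFree hΓ h0 hD hfr h
    exact hinv g _ _ hxy
  obtain ⟨n, hn⟩ := hS.exists_subset (X := {u, v}) (by simp)
  -- Extending the empty map freely moves all of `S n` away from itself, so `g u` is free from both
  -- `u` and `v`.
  let i : (⊥ : Digraph PEmpty.{1}).Adj ↪r D.Adj :=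
    ⟨⟨PEmpty.elim, fun x => x.elim⟩, fun {x} => x.elim⟩
  have hi : range i = ∅ := range_eq_empty _
  have his : D.IsStrong (range i) := hi ▸ hD.isStrong_empty hΓ h0
  obtain ⟨g, -, hfree, hsub, hdesc⟩ := hS.exists_aut_extending i i his his (n := n)
    (hi ▸ empty_subset _) (hi ▸ empty_subset _)
  have hw : ∀ x ∈ S n, r x (g u) := fun x hx => hall _ _
    (hS.areFree hD hfree hsub hdesc hx (hn (by simp)) (by simp [hi]) (by simp [hi]))
  exact hr.trans (hw u (hn (by simp))) (hr.symm (hw v (hn (by simp))))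

end Homogeneous

/-! ### Descent to a countable digraph. -/

section Countable

variable {V : Type u} {W : Type v} {Γ : Digraph V} {γ : V} {D : Digraph W}

theorem exists_countable_closed (c : W → Set W) (hc : ∀ x, (c x).Countable)
    (F : W → W → W → W → Set D.Aut) (hF : ∀ x y z t, (F x y z t).Countable) (x₀ : W) :
    ∃ A : Set W, x₀ ∈ A ∧ A.Countable ∧ (∀ x ∈ A, c x ⊆ A) ∧
      ∀ x ∈ A, ∀ y ∈ A, ∀ z ∈ A, ∀ t ∈ A, ∀ g ∈ F x y z t, ∀ w ∈ A, g w ∈ A ∧ g.symm w ∈ A := by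
  let G : Set W → Set D.Aut := fun A => ⋃ x ∈ A, ⋃ y ∈ A, ⋃ z ∈ A, ⋃ t ∈ A, F x y z t
  let Φ : Set W → Set W := fun A =>
    A ∪ (⋃ x ∈ A, c x) ∪ ((⋃ g ∈ G A, g '' A) ∪ ⋃ g ∈ G A, g.symm '' A)
  have hΦ : ∀ A : Set W, A.Countable → (Φ A).Countable := by
    intro A hA
    have hG : (G A).Countable := hA.biUnion fun x _ => hA.biUnion fun y _ =>
      hA.biUnion fun z _ => hA.biUnion fun t _ => hF x y z t
    exact (hA.union (hA.biUnion fun x _ => hc x)).union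
      ((hG.biUnion fun g _ => hA.image g).union (hG.biUnion fun g _ => hA.image g.symm))
  let A : ℕ → Set W := fun n => Φ^[n] {x₀}
  have hsucc : ∀ n, A (n + 1) = Φ (A n) := fun n => Function.iterate_succ_apply' Φ n _
  have hmono : Monotone A := monotone_nat_of_le_succ fun n => by
    rw [hsucc]
    exact subset_union_left.trans subset_union_left
  have hcount : ∀ n, (A n).Countable := by
    intro n
    induction n with
    | zero => exact countable_singleton x₀
    | succ n ih =>
      rw [hsucc]
      exact hΦ _ ih
  refine ⟨⋃ n, A n, mem_iUnion.2 ⟨0, rfl⟩, countable_iUnion hcount, ?_, ?_⟩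
  · intro x hx y hy
    obtain ⟨n, hn⟩ := mem_iUnion.1 hx
    refine mem_iUnion.2 ⟨n + 1, ?_⟩
    rw [hsucc]
    exact .inl (.inr (mem_biUnion hn hy))
  · intro x hx y hy z hz t ht g hg w hw
    obtain ⟨a, ha⟩ := mem_iUnion.1 hx
    obtain ⟨b, hb⟩ := mem_iUnion.1 hy
    obtain ⟨d, hd⟩ := mem_iUnion.1 hz
    obtain ⟨e, he⟩ := mem_iUnion.1 ht
    obtain ⟨f, hf⟩ := mem_iUnion.1 hw
    have hm : ∀ k, k ≤ a + b + d + e + f → A k ⊆ A (a + b + d + e + f) := fun k hk => hmono hk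
    have hgG : g ∈ G (A (a + b + d + e + f)) :=
      mem_biUnion (hm a (by omega) ha) (mem_biUnion (hm b (by omega) hb)
        (mem_biUnion (hm d (by omega) hd) (mem_biUnion (hm e (by omega) he) hg)))
    have hw' := hm f (by omega) hf
    constructor <;> refine mem_iUnion.2 ⟨a + b + d + e + f + 1, ?_⟩ <;> rw [hsucc]
    · exact .inr (.inl (mem_biUnion hgG ⟨w, hw', rfl⟩))
    · exact .inr (.inr (mem_biUnion hgG ⟨w, hw', rfl⟩))

theorem exists_countable_eqvGen {x y z t : W}
    (h : EqvGen (fun a b => ∃ g : D.Aut, g x = a ∧ g y = b) z t) :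
    ∃ F : Set D.Aut, F.Countable ∧ EqvGen (fun a b => ∃ g ∈ F, g x = a ∧ g y = b) z t := by
  have hmono : ∀ {F F' : Set D.Aut} {a b : W}, F ⊆ F' →
      EqvGen (fun a b => ∃ g ∈ F, g x = a ∧ g y = b) a b →
      EqvGen (fun a b => ∃ g ∈ F', g x = a ∧ g y = b) a b := fun hF h =>
    h.mono fun _ _ ⟨g, hg, hab⟩ => ⟨g, hF hg, hab⟩
  induction h with
  | rel a b h =>
    obtain ⟨g, hg⟩ := h
    exact ⟨{g}, countable_singleton g, .rel _ _ ⟨g, rfl, hg⟩⟩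
  | refl a => exact ⟨∅, countable_empty, .refl _⟩
  | symm a b _ ih =>
    obtain ⟨F, hF, h⟩ := ih
    exact ⟨F, hF, .symm _ _ h⟩
  | trans a b c _ _ ih ih' =>
    obtain ⟨F, hF, h⟩ := ih
    obtain ⟨F', hF', h'⟩ := ih'
    exact ⟨F ∪ F', hF.union hF', .trans _ _ _ (hmono subset_union_left h)
      (hmono subset_union_right h')⟩

variable {X : Type w} {E : Digraph X}

theorem IsLocally.of_embedding (hD : Γ.IsLocally D) (i : E.Adj ↪r D.Adj)
    (hi : D.IsDescClosed (range i)) : Γ.IsLocally E where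
  asymm := hD.asymm.of_embedding i
  exists_embedding a := by
    obtain ⟨θ, hθ⟩ := hD.exists_embedding (i a)
    rw [desc_apply i hD.asymm hi] at hθ
    have hex : ∀ x, ∃ y ∈ E.desc a, i y = θ x := fun x => hθ.subset (mem_range_self x)
    choose f hf hif using hex
    refine ⟨⟨⟨f, fun x y h => θ.injective (by rw [← hif, ← hif, h])⟩, ?_⟩, ?_⟩
    · intro x y
      rw [← i.map_rel_iff]
      change D.Adj (i (f x)) (i (f y)) ↔ _
      rw [hif, hif, θ.map_rel_iff]
    · ext y
      constructor
      · rintro ⟨x, rfl⟩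
        exact hf x
      · intro hy
        obtain ⟨x, hx⟩ : i y ∈ range θ := hθ ▸ ⟨y, hy, rfl⟩
        exact ⟨x, i.injective ((hif x).trans hx)⟩
  strong a := by
    refine IsStrong.of_image i hD.asymm hi ?_
    rw [← desc_apply i hD.asymm hi]
    exact hD.strong _

theorem exists_aut_restrict (i : E.Adj ↪r D.Adj) (g : D.Aut)
    (hg : ∀ x ∈ range i, g x ∈ range i ∧ g.symm x ∈ range i) :
    ∃ g' : E.Aut, ∀ x, i (g' x) = g (i x) := by
  choose f hf using fun x => (hg (i x) ⟨x, rfl⟩).1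
  choose f' hf' using fun x => (hg (i x) ⟨x, rfl⟩).2
  refine ⟨⟨⟨f, f', fun x => i.injective ?_, fun x => i.injective ?_⟩, ?_⟩, hf⟩
  · rw [hf', hf, g.symm_apply_apply]
  · rw [hf, hf', g.apply_symm_apply]
  · intro x y
    rw [← i.map_rel_iff]
    simp only [Equiv.coe_fn_mk, hf, g.map_rel_iff, i.map_rel_iff]

/-- Passage to a countable digraph which inherits the properties of a homogeneous one. -/
theorem IsFreeFiltration.exists_countable [Nonempty W] (hΓ : Γ.IsAsymmetric) (h0 : Γ.P0 γ)
    (h3 : Γ.P3 γ) (hD : Γ.IsLocally D) {S : ℕ → Set W} (hS : D.IsFreeFiltration S) :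
    ∃ E : Digraph ℕ, Γ.IsLocally E ∧ E.IsPrimitive ∧ (∀ a, (E.inSet a).Infinite) ∧
      E.IsDistanceTransitive := by
  -- `F` serves two purposes: an automorphism taking `(x, y)` to `(z, t)`, and a chain from `z` to
  -- `t` through images of the pair `(x, y)`. The chain expresses primitivity without quantifying
  -- over relations, so it survives restriction.
  have hF : ∀ x y z t : W, ∃ F : Set D.Aut, F.Countable ∧
      ((∃ g : D.Aut, g x = z ∧ g y = t) → ∃ g ∈ F, g x = z ∧ g y = t) ∧
      (x ≠ y → EqvGen (fun a b => ∃ g ∈ F, g x = a ∧ g y = b) z t) := by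
    intro x y z t
    obtain ⟨F, hFc, hF⟩ : ∃ F : Set D.Aut, F.Countable ∧
        (x ≠ y → EqvGen (fun a b => ∃ g ∈ F, g x = a ∧ g y = b) z t) := by
      by_cases hxy : x = y
      · exact ⟨∅, countable_empty, fun h => (h hxy).elim⟩
      · have hinv : ∀ (g : D.Aut) a b, EqvGen (fun a b => ∃ g : D.Aut, g x = a ∧ g y = b) a b →
            EqvGen (fun a b => ∃ g : D.Aut, g x = a ∧ g y = b) (g a) (g b) := by
          intro g a b h
          induction h with
          | rel a b h =>
            obtain ⟨g', rfl, rfl⟩ := h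
            exact .rel _ _ ⟨g'.trans g, rfl, rfl⟩
          | refl a => exact .refl _
          | symm a b _ ih => exact .symm _ _ ih
          | trans a b c _ _ ih ih' => exact .trans _ _ _ ih ih'
        obtain ⟨F, hFc, hF⟩ := exists_countable_eqvGen (hS.rel_of_ne hΓ h0 h3 hD
          (EqvGen.is_equivalence _) hinv hxy (.rel _ _ ⟨RelIso.refl _, rfl, rfl⟩) z t)
        exact ⟨F, hFc, fun _ => hF⟩
    by_cases hex : ∃ g : D.Aut, g x = z ∧ g y = t
    · obtain ⟨g, hg⟩ := hex
      exact ⟨insert g F, hFc.insert g, fun _ => ⟨g, mem_insert _ _, hg⟩, fun h =>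
        (hF h).mono fun _ _ ⟨g, hg, hab⟩ => ⟨g, mem_insert_of_mem _ hg, hab⟩⟩
    · exact ⟨F, hFc, fun h => (hex h).elim, hF⟩
  choose F hFc hFaut hFgen using hF
  -- In-sets may be uncountable, so the closure uses only a countably infinite part of each.
  have hJ : ∀ x, ∃ J ⊆ D.inSet x, J.Infinite ∧ J.Countable := fun x =>
    let f := (hS.infinite_inSet hΓ h0 h3 hD x).natEmbedding
    ⟨range fun n => (f n : W), range_subset_iff.2 fun n => (f n).2,
      infinite_range_of_injective (Subtype.val_injective.comp f.injective), countable_range _⟩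
  choose J hJsub hJinf hJc using hJ
  obtain ⟨A, hx₀, hAc, hAcl, hAF⟩ := exists_countable_closed (fun x => D.desc x ∪ J x)
    (fun x => (hD.countable_desc hΓ h0 x).union (hJc x)) F hFc (Classical.arbitrary W)
  have hAinf : A.Infinite := (hD.infinite_desc hΓ h0 _).mono (subset_union_left.trans (hAcl _ hx₀))
  have := hAc.to_subtype
  have := hAinf.to_subtype
  obtain ⟨e⟩ : Nonempty (ℕ ≃ A) := inferInstance
  let E : Digraph ℕ := ⟨fun m n => D.Adj (e m) (e n)⟩
  let i : E.Adj ↪r D.Adj := ⟨⟨fun n => e n, Subtype.val_injective.comp e.injective⟩, Iff.rfl⟩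
  have hi : range i = A := by
    ext x
    exact ⟨fun ⟨n, hn⟩ => hn ▸ (e n).2, fun hx => ⟨e.symm ⟨x, hx⟩,
      congrArg Subtype.val (e.apply_symm_apply ⟨x, hx⟩)⟩⟩
  have hiA : ∀ n, i n ∈ A := fun n => (e n).2
  have hcl : D.IsDescClosed (range i) := hi ▸ fun x hx => subset_union_left.trans (hAcl x hx)
  have hE := hD.of_embedding i hcl
  have hres : ∀ x y z t : ℕ, ∀ g ∈ F (i x) (i y) (i z) (i t), ∃ g' : E.Aut,
      ∀ n, i (g' n) = g (i n) := fun x y z t g hg =>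
    exists_aut_restrict i g (hi ▸ hAF _ (hiA x) _ (hiA y) _ (hiA z) _ (hiA t) g hg)
  have hdist : ∀ s u v u' v', E.HasWalk s u v → E.HasWalk s u' v' →
      ∃ g : E.Aut, g u = u' ∧ g v = v' := by
    intro s u v u' v' h h'
    obtain ⟨g, hg, h1, h2⟩ := hFaut _ _ _ _
      (hS.exists_aut_of_hasWalk hΓ h0 h3 hD (h.map i) (h'.map i))
    obtain ⟨g', hg'⟩ := hres u v u' v' g hg
    exact ⟨g', i.injective ((hg' u).trans h1), i.injective ((hg' v).trans h2)⟩
  refine ⟨E, hE, ?_, ?_, ?_⟩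
  · have htrans : MulAction.IsPretransitive E.Aut ℕ := ⟨fun u v => by
      obtain ⟨g, hg, -⟩ := hdist 0 u u v v rfl rfl
      exact ⟨g, hg⟩⟩
    refine { htrans with isTrivialBlock_of_isBlock := fun {B} hB => ?_ }
    rw [MulAction.IsTrivialBlock, or_iff_not_imp_left, not_subsingleton_iff]
    rintro ⟨x, hx, y, hy, hxy⟩
    have hmem : ∀ g : E.Aut, ∀ a ∈ B, ∀ b ∈ B, g a ∈ B → g b ∈ B := by
      intro g a ha b hb hga
      have := hB.smul_eq_of_mem ha (g := g) hga
      rw [← this]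
      exact Set.smul_mem_smul_set (a := g) hb
    -- Every image of the pair `(x, y)` lies wholly inside or wholly outside the block, so a chain
    -- of such images starting in `B` never leaves it.
    have key : ∀ z t : W, EqvGen (fun a b => ∃ g : E.Aut, i (g x) = a ∧ i (g y) = b) z t →
        (z ∈ i '' B ↔ t ∈ i '' B) := by
      intro z t h
      induction h with
      | rel a b h =>
        obtain ⟨g, rfl, rfl⟩ := h
        rw [i.injective.mem_set_image, i.injective.mem_set_image]
        exact ⟨hmem g x hx y hy, hmem g y hy x hx⟩
      | refl a => exact Iff.rfl
      | symm a b _ ih => exact ih.symm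
      | trans a b c _ _ ih ih' => exact ih.trans ih'
    refine eq_univ_of_forall fun n => ?_
    rw [← i.injective.mem_set_image (s := B)]
    refine (key (i x) (i n) ?_).1 ⟨x, hx, rfl⟩
    refine (hFgen (i x) (i y) (i x) (i n) fun h => hxy (i.injective h)).mono ?_
    rintro a b ⟨g, hg, rfl, rfl⟩
    obtain ⟨g', hg'⟩ := hres x y x n g hg
    exact ⟨g', hg' x, hg' y⟩
  · intro a hfin
    refine hJinf (i a) ((hfin.image i).subset fun w hw => ?_)
    obtain ⟨n, rfl⟩ : w ∈ range i := hi ▸ hAcl _ (hiA a) (.inr hw)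
    exact ⟨n, hJsub _ hw, rfl⟩
  · intro s u v u' v' h h'
    exact hdist s u v u' v' ((hasArc_iff_hasWalk hE.asymm).1 h.1)
      ((hasArc_iff_hasWalk hE.asymm).1 h'.1)

end Countable

end Digraph

theorem mainTheorem2 {V : Type*} (Γ : Digraph V) (γ : V)
    (hasymm : Γ.IsAsymmetric)
    (h0 : Γ.P0 γ) (h1 : Γ.P1) (h2 : Γ.P2) (h3 : Γ.P3 γ) :
    ∃ (W : Type) (D : Digraph W),
      Nonempty W ∧ Countable W ∧ D.IsAsymmetric ∧
      D.IsPrimitive ∧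
      (∀ a, (D.inSet a).Infinite) ∧
      (∀ a, Nonempty (Digraph.Iso (D.induced (D.desc a)) Γ)) ∧
      D.IsDistanceTransitive := by
  have hΓ := Digraph.isLocally_self hasymm h1 h2
  have : Nonempty Γ.Limit := ⟨.inl γ⟩
  obtain ⟨E, hE, hprim, hin, hdist⟩ :=
    hΓ.isFreeFiltration_limit.exists_countable hasymm h0 h3 hΓ.limit
  exact ⟨ℕ, E, inferInstance, inferInstance, hE.asymm, hprim, hin, hE.nonempty_iso, hdist⟩
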